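/- Let $\Bbbk$ be a commutative ring, $n\ge 1$ and $r\ge 0$. Let $\mathrm{AH}_r$ be the degenerate affine Hecke algebra: the $\Bbbk$-algebra with generators $x_1,\dots,x_r,s_1,\dots,s_{r-1}$, where the $x_i$ commute with each other, the $s_i$ satisfy the Coxeter relations of the basic transpositions of the symmetric group $S_r$, and $s_ix_i=x_{i+1}s_i+1$, $x_is_i=s_ix_{i+1}+1$, $x_is_j=s_jx_i$ for $i\ne j,j+1$. Let $\mathrm P^{(r)}=\Bbbk[x_1,\dots,x_r]^{S_r}$ be the algebra of symmetric polynomials. Let $\Lambda(n,r)$ be the set of $\lambda\in\mathbb N^n$ with $\lambda_1+\cdots+\lambda_n=r$. For $\lambda\in\Lambda(n,r)$, let $S_\lambda=S_{\lambda_1}\times\cdots\times S_{\lambda_n}\le S_r$ and let $M(\lambda)=\Bbbk_\lambda\otimes_{\Bbbk S_\lambda}\Bbbk S_r$ be the right permutation module, where $\Bbbk_\lambda$ is the trivial module, with generator $m_\lambda=1\otimes 1$. The degenerate affine Schur algebra is $$\mathrm{AS}(n,r)=\operatorname{End}_{\mathrm{AH}_r}\Big(\bigoplus_{\lambda\in\Lambda(n,r)}M(\lambda)\otimes_{\Bbbk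 S_r}\mathrm{AH}_r\Big),$$ the algebra of endomorphisms of right $\mathrm{AH}_r$-modules. For $f\in\mathrm P^{(r)}$, let $f1_\lambda\in\mathrm{AS}(n,r)$ be the endomorphism that sends $m_\lambda\otimes 1$ to $m_\lambda\otimes f$ and is zero on the summands indexed by $\mu\ne\lambda$, and put $f1_{n,r}=\sum_{\lambda\in\Lambda(n,r)}f1_\lambda$. Then $f\mapsto f1_{n,r}$ is an isomorphism of $\Bbbk$-algebras from $\mathrm P^{(r)}$ onto the center of $\mathrm{AS}(n,r)$. -/

import Mathlib

open scoped DirectSum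

noncomputable section

namespace DegAffSchur

/-! ### Compositions, parabolic subgroups and permutation modules -/

/-- Compositions of `r` with `n` parts (zero parts allowed). -/
def Comp (n r : ℕ) : Type := {c : Fin n → ℕ // ∑ i, c i = r}

instance (n r : ℕ) : DecidableEq (Comp n r) :=
  inferInstanceAs (DecidableEq {c : Fin n → ℕ // ∑ i, c i = r})

instance (n r : ℕ) : Fintype (Comp n r) :=
  Fintype.subtype (Finset.Nat.antidiagonalTuple n r)
    fun _ => Finset.Nat.mem_antidiagonalTuple

/-- Index set of the basic transpositions: `i` stands for the transposition of the
(zero-based) positions `i` and `i + 1`. -/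
def Simple (r : ℕ) : Type := {i : ℕ // i + 1 < r}

namespace Simple

variable {r : ℕ}

/-- The position `i`. -/
def left (i : Simple r) : Fin r := ⟨i.1, Nat.lt_of_succ_lt i.2⟩

/-- The position `i + 1`. -/
def right (i : Simple r) : Fin r := ⟨i.1 + 1, i.2⟩

/-- The basic transposition in the symmetric group. -/
def perm (i : Simple r) : Equiv.Perm (Fin r) := Equiv.swap i.left i.right

theorem left_ne_right (i : Simple r) : i.left ≠ i.right := by
  intro h
  have := congrArg Fin.val h
  simp [left, right] at this

end Simple

/-- The position `j` lies in the `i`-th block of the composition `c`, that is,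
`c_1 + ... + c_{i-1} ≤ j < c_1 + ... + c_i` (positions are counted from `0`). -/
def InBlock {n r : ℕ} (c : Comp n r) (i : Fin n) (j : Fin r) : Prop :=
  ∑ a ∈ Finset.Iio i, c.1 a ≤ j ∧ (j : ℕ) < ∑ a ∈ Finset.Iic i, c.1 a

/-- The parabolic subgroup `S_{c_1} × ... × S_{c_n}` of `S_r`: the permutations that
preserve each block of `c`. -/
def parabolic {n r : ℕ} (c : Comp n r) : Subgroup (Equiv.Perm (Fin r)) where
  carrier := {w | ∀ i j, InBlock c i (w j) ↔ InBlock c i j}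
  one_mem' := fun _ _ => Iff.rfl
  mul_mem' := fun {v w} hv hw i j => (hv i (w j)).trans (hw i j)
  inv_mem' := fun {w} hw i j => by
    have h := hw i (w⁻¹ j)
    have e : w (w⁻¹ j) = j := w.apply_symm_apply j
    rw [e] at h
    exact h.symm

/-- The set `S_c \ S_r` of right cosets `S_c g`. It is the standard basis of the permutation
module `M(c)`. -/
def Coset {n r : ℕ} (c : Comp n r) : Type :=
  Quotient (QuotientGroup.rightRel (parabolic c))

/-- The right coset `S_c g`; as an element of `M(c)` this is the vector `m_c g`. -/
def Coset.mk {n r : ℕ} (c : Comp n r) (g : Equiv.Perm (Fin r)) : Coset c :=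
  Quotient.mk (QuotientGroup.rightRel (parabolic c)) g

/-- The right action of the symmetric group on right cosets, `(S_c g) w = S_c (g w)`. -/
def Coset.act {n r : ℕ} {c : Comp n r} (w : Equiv.Perm (Fin r)) (x : Coset c) : Coset c :=
  Quotient.map' (s₁ := QuotientGroup.rightRel (parabolic c))
    (s₂ := QuotientGroup.rightRel (parabolic c)) (fun g => g * w)
    (fun a b hab => by
      rw [QuotientGroup.rightRel_apply] at hab ⊢
      simpa [mul_assoc] using hab) x

/-! ### The degenerate affine Hecke algebra -/

/-- Generators `x_1, ..., x_r` and `s_1, ..., s_{r-1}`. -/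
inductive Gen (r : ℕ) : Type
  | x (i : Fin r) : Gen r
  | s (i : Simple r) : Gen r

section Hecke

variable (k : Type*) [CommRing k] (r : ℕ)

/-- The generator `x_i` in the free algebra. -/
abbrev fx (i : Fin r) : FreeAlgebra k (Gen r) := FreeAlgebra.ι k (Gen.x i)

/-- The generator `s_i` in the free algebra. -/
abbrev fs (i : Simple r) : FreeAlgebra k (Gen r) := FreeAlgebra.ι k (Gen.s i)

/-- The defining relations of the degenerate affine Hecke algebra. -/
inductive HeckeRel : FreeAlgebra k (Gen r) → FreeAlgebra k (Gen r) → Prop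
  | x_comm (i j : Fin r) : HeckeRel (fx k r i * fx k r j) (fx k r j * fx k r i)
  | s_sq (i : Simple r) : HeckeRel (fs k r i * fs k r i) 1
  | s_comm (i j : Simple r) (h : i.1 + 1 < j.1) :
      HeckeRel (fs k r i * fs k r j) (fs k r j * fs k r i)
  | s_braid (i j : Simple r) (h : i.1 + 1 = j.1) :
      HeckeRel (fs k r i * fs k r j * fs k r i) (fs k r j * fs k r i * fs k r j)
  | s_x (i : Simple r) :
      HeckeRel (fs k r i * fx k r i.left) (fx k r i.right * fs k r i + 1)
  | x_s (i : Simple r) :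
      HeckeRel (fx k r i.left * fs k r i) (fs k r i * fx k r i.right + 1)
  | x_s_comm (i : Fin r) (j : Simple r) (h : i ≠ j.left) (h' : i ≠ j.right) :
      HeckeRel (fx k r i * fs k r j) (fs k r j * fx k r i)

/-- The degenerate affine Hecke algebra `AH_r` over `k`. -/
def AH : Type _ := RingQuot (HeckeRel k r)

instance : Ring (AH k r) := inferInstanceAs (Ring (RingQuot (HeckeRel k r)))

instance : Algebra k (AH k r) := inferInstanceAs (Algebra k (RingQuot (HeckeRel k r)))

namespace AH

/-- The projection from the free algebra. -/
def proj : FreeAlgebra k (Gen r) →ₐ[k] AH k r := RingQuot.mkAlgHom k (HeckeRel k r)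

/-- The element `x_i` of `AH_r`. -/
def x (i : Fin r) : AH k r := proj k r (fx k r i)

/-- The element `s_i` of `AH_r`. -/
def s (i : Simple r) : AH k r := proj k r (fs k r i)

variable {k r}

theorem proj_rel {a b : FreeAlgebra k (Gen r)} (h : HeckeRel k r a b) :
    proj k r a = proj k r b :=
  RingQuot.mkAlgHom_rel k h

theorem x_comm (i j : Fin r) : x k r i * x k r j = x k r j * x k r i := by
  simpa [x] using proj_rel (HeckeRel.x_comm (k := k) i j)

theorem s_x (i : Simple r) : s k r i * x k r i.left = x k r i.right * s k r i + 1 := by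
  simpa [x, s] using proj_rel (HeckeRel.s_x (k := k) i)

theorem x_s (i : Simple r) : x k r i.left * s k r i = s k r i * x k r i.right + 1 := by
  simpa [x, s] using proj_rel (HeckeRel.x_s (k := k) i)

theorem x_s_comm (i : Fin r) (j : Simple r) (h : i ≠ j.left) (h' : i ≠ j.right) :
    x k r i * s k r j = s k r j * x k r i := by
  simpa [x, s] using proj_rel (HeckeRel.x_s_comm (k := k) i j h h')

theorem range_x_comm : ∀ a ∈ Set.range (x k r), ∀ b ∈ Set.range (x k r), a * b = b * a := by
  rintro _ ⟨i, rfl⟩ _ ⟨j, rfl⟩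
  exact x_comm i j

variable (k r)

/-- The algebra homomorphism `P_r = k[x_1, ..., x_r] → AH_r` sending `x_i` to `x_i`, by which
polynomials are regarded as elements of `AH_r`. -/
def ofPoly : MvPolynomial (Fin r) k →ₐ[k] AH k r :=
  have hc := Algebra.isMulCommutative_adjoin k (range_x_comm (k := k) (r := r))
  letI : CommRing (Algebra.adjoin k (Set.range (x k r))) :=
    { (Algebra.adjoin k (Set.range (x k r))).toRing with
      mul_comm := hc.is_comm.comm }
  (Algebra.adjoin k (Set.range (x k r))).val.comp
    (MvPolynomial.aeval fun i => ⟨x k r i, Algebra.subset_adjoin (Set.mem_range_self i)⟩)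

variable {k r}

@[simp]
theorem ofPoly_X (i : Fin r) : ofPoly k r (MvPolynomial.X i) = x k r i := by
  simp [ofPoly]

/-- `x_i - x_j` is not a zero divisor in a polynomial ring over any commutative ring. -/
theorem eq_zero_of_X_mul_eq {i j : Fin r} (hij : i ≠ j) (g : MvPolynomial (Fin r) k)
    (h : MvPolynomial.X i * g = MvPolynomial.X j * g) : g = 0 := by
  have key : ∀ (d : ℕ) (m : Fin r →₀ ℕ), m j = d → g.coeff m = 0 := by
    intro d
    induction d with
    | zero =>
      intro m hm
      have h1 := congrArg (MvPolynomial.coeff (Finsupp.single i 1 + m)) h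
      rw [MvPolynomial.coeff_X_mul, MvPolynomial.coeff_X_mul', if_neg] at h1
      · exact h1
      · simp [hm, hij]
    | succ d ih =>
      intro m hm
      have h1 := congrArg (MvPolynomial.coeff (Finsupp.single i 1 + m)) h
      rw [MvPolynomial.coeff_X_mul, MvPolynomial.coeff_X_mul', if_pos] at h1
      · rw [h1]
        apply ih
        simp [hm, hij]
      · simp [hm, hij]
  ext m
  simpa using key _ m rfl

/-- The commutation rule `s_i f = s_i(f) s_i + ∂_i(f)`, where `∂_i(f)` is the quotient of
`f - s_i(f)` by `x_i - x_{i+1}`. -/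
theorem exists_demazure (i : Simple r) (f : MvPolynomial (Fin r) k) :
    ∃ g : MvPolynomial (Fin r) k,
      (MvPolynomial.X i.left - MvPolynomial.X i.right) * g
          = f - MvPolynomial.rename i.perm f ∧
      s k r i * ofPoly k r f
          = ofPoly k r (MvPolynomial.rename i.perm f) * s k r i + ofPoly k r g := by
  induction f using MvPolynomial.induction_on with
  | C a =>
    refine ⟨0, by simp, ?_⟩
    have : ofPoly k r (MvPolynomial.C a) = algebraMap k (AH k r) a :=
      (ofPoly k r).commutes a
    simp [this, Algebra.commutes]
  | add p q hp hq =>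
    obtain ⟨g, h1, h2⟩ := hp
    obtain ⟨g', h1', h2'⟩ := hq
    refine ⟨g + g', ?_, ?_⟩
    · rw [mul_add, h1, h1', map_add]; ring
    · rw [map_add, mul_add, h2, h2', map_add, map_add, map_add]; noncomm_ring
  | mul_X p j hp =>
    obtain ⟨g, h1, h2⟩ := hp
    have hX : ∃ d : MvPolynomial (Fin r) k,
        (MvPolynomial.X i.left - MvPolynomial.X i.right) * d
          = MvPolynomial.X j - MvPolynomial.X (i.perm j) ∧
        s k r i * x k r j = x k r (i.perm j) * s k r i + ofPoly k r d := by
      by_cases hl : j = i.left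
      · subst hl
        exact ⟨1, by simp [Simple.perm], by simp [Simple.perm, s_x]⟩
      · by_cases hr : j = i.right
        · subst hr
          refine ⟨-1, by simp [Simple.perm], ?_⟩
          simp [Simple.perm, x_s]
        · refine ⟨0, ?_, ?_⟩
          · simp [Simple.perm, Equiv.swap_apply_of_ne_of_ne hl hr]
          · simp [Simple.perm, Equiv.swap_apply_of_ne_of_ne hl hr, x_s_comm j i hl hr]
    obtain ⟨d, hd1, hd2⟩ := hX
    refine ⟨g * MvPolynomial.X j + MvPolynomial.rename i.perm p * d, ?_, ?_⟩
    · rw [map_mul, MvPolynomial.rename_X]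
      linear_combination MvPolynomial.X j * h1 + MvPolynomial.rename i.perm p * hd1
    · rw [map_mul, ← mul_assoc, h2, ofPoly_X, add_mul, mul_assoc, hd2]
      simp only [map_mul, map_add, MvPolynomial.rename_X, ofPoly_X]
      noncomm_ring

/-- Symmetric polynomials commute with every `s_i`. -/
theorem s_mul_ofPoly (i : Simple r) {f : MvPolynomial (Fin r) k} (hf : f.IsSymmetric) :
    s k r i * ofPoly k r f = ofPoly k r f * s k r i := by
  obtain ⟨g, h1, h2⟩ := exists_demazure i f
  rw [hf i.perm] at h1 h2
  rw [sub_self, sub_mul, sub_eq_zero] at h1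
  rw [h2, eq_zero_of_X_mul_eq i.left_ne_right g h1, map_zero, add_zero]

end AH

end Hecke

/-! ### The induced modules `M(c) ⊗_{k S_r} AH_r` (right modules are modules over the
opposite ring) -/

section Schur

variable (k : Type*) [CommRing k] {n r : ℕ}

/-- Since `M(c)` is free over `k` with basis the right cosets of `S_c`, the right `AH_r`-module
`M(c) ⊗_k AH_r` is the module of finitely supported functions from these cosets to `AH_r`,
where `single y h` is the pure tensor `y ⊗ h`. The balancing relations of the tensor product
over `k S_r` are `y s_i ⊗ h = y ⊗ s_i h`; it suffices to impose them for the
basic transpositions, because these generate the algebra `k S_r`. -/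
def balance (c : Comp n r) : Submodule (AH k r)ᵐᵒᵖ (Coset c →₀ AH k r) :=
  Submodule.span _ (Set.range fun t : Coset c × Simple r × AH k r =>
    Finsupp.single (t.1.act t.2.1.perm) t.2.2
      - Finsupp.single t.1 (AH.s k r t.2.1 * t.2.2))

/-- The right `AH_r`-module `M(c) ⊗_{k S_r} AH_r`. -/
def IndMod (c : Comp n r) : Type _ := (Coset c →₀ AH k r) ⧸ balance k c

instance (c : Comp n r) : AddCommGroup (IndMod k c) :=
  inferInstanceAs (AddCommGroup ((Coset c →₀ AH k r) ⧸ balance k c))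

instance (c : Comp n r) : Module (AH k r)ᵐᵒᵖ (IndMod k c) :=
  inferInstanceAs (Module (AH k r)ᵐᵒᵖ ((Coset c →₀ AH k r) ⧸ balance k c))

instance (c : Comp n r) : Module k (IndMod k c) :=
  inferInstanceAs (Module k ((Coset c →₀ AH k r) ⧸ balance k c))

instance (c : Comp n r) : IsScalarTower k (AH k r)ᵐᵒᵖ (IndMod k c) :=
  inferInstanceAs (IsScalarTower k (AH k r)ᵐᵒᵖ ((Coset c →₀ AH k r) ⧸ balance k c))

/-- The pure tensor `y ⊗ h`, for a standard basis vector `y` of `M(c)`. -/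
def IndMod.tmul {c : Comp n r} (y : Coset c) (h : AH k r) : IndMod k c :=
  Submodule.Quotient.mk (Finsupp.single y h)

/-- Left multiplication by a fixed element, as an endomorphism of the right regular module. -/
def mulLeftEnd (a : AH k r) : AH k r →ₗ[(AH k r)ᵐᵒᵖ] AH k r where
  toFun h := a * h
  map_add' := mul_add a
  map_smul' b h := by simp [MulOpposite.smul_eq_mul_unop, mul_assoc]

/-- For a symmetric polynomial `f`, the right `AH_r`-module endomorphism of
`M(c) ⊗_{k S_r} AH_r` with `m_c ⊗ 1 ↦ m_c ⊗ f`. -/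
def symEnd (c : Comp n r) (f : MvPolynomial.symmetricSubalgebra (Fin r) k) :
    IndMod k c →ₗ[(AH k r)ᵐᵒᵖ] IndMod k c :=
  Submodule.mapQ (balance k c) (balance k c)
    (Finsupp.mapRange.linearMap (mulLeftEnd k (AH.ofPoly k r f.1)))
    (by
      rw [balance, Submodule.span_le]
      rintro _ ⟨⟨y, i, h⟩, rfl⟩
      refine Submodule.subset_span ⟨⟨y, i, AH.ofPoly k r f.1 * h⟩, ?_⟩
      rw [map_sub, Finsupp.mapRange.linearMap_apply, Finsupp.mapRange.linearMap_apply,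
        Finsupp.mapRange_single, Finsupp.mapRange_single]
      simp only [mulLeftEnd, LinearMap.coe_mk, AddHom.coe_mk]
      rw [← mul_assoc, ← mul_assoc, AH.s_mul_ofPoly i f.2])

/-- `symEnd k c f` sends the cyclic generator `m_c ⊗ 1` to `m_c ⊗ f`. -/
theorem symEnd_gen (c : Comp n r) (f : MvPolynomial.symmetricSubalgebra (Fin r) k) :
    symEnd k c f (IndMod.tmul k (Coset.mk c 1) 1)
      = IndMod.tmul k (Coset.mk c 1) (AH.ofPoly k r f.1) := by
  refine (Submodule.mapQ_apply _ _ _ _).trans ?_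
  simp [IndMod.tmul, mulLeftEnd]

variable (n r)

/-- The direct sum of the modules `M(c) ⊗_{k S_r} AH_r` over all compositions `c` of `r` with
`n` parts. -/
abbrev TensorMod : Type _ := ⨁ c : Comp n r, IndMod k c

/-- The degenerate affine Schur algebra `AS(n,r)`. -/
abbrev AS : Type _ := Module.End (AH k r)ᵐᵒᵖ (TensorMod k n r)

variable {n r}

/-- The element `f 1_c` of `AS(n,r)`: it is `m_c ⊗ 1 ↦ m_c ⊗ f` on the summand indexed by `c`
and zero on the other summands. -/
def polyIdem (c : Comp n r) (f : MvPolynomial.symmetricSubalgebra (Fin r) k) : AS k n r :=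
  DirectSum.lof (AH k r)ᵐᵒᵖ (Comp n r) (fun c => IndMod k c) c ∘ₗ symEnd k c f ∘ₗ
    DirectSum.component (AH k r)ᵐᵒᵖ (Comp n r) (fun c => IndMod k c) c

variable (n)

/-- The element `f 1_{n,r} = ∑_c f 1_c` of `AS(n,r)`. -/
def polyOne (f : MvPolynomial.symmetricSubalgebra (Fin r) k) : AS k n r :=
  ∑ c : Comp n r, polyIdem k c f

end Schur

end DegAffSchur

end

/-!
Everything is tested against one module: the polynomial algebra `P_r = k[x_1, …, x_r]` as a right
`AH_r`-module, on which `x_i` acts by multiplication and `s_i` by `g ↦ s_i g + ∂_i g` with the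
Demazure operator `∂_i`. For the composition `(r, 0, …, 0)` it is a direct summand of the tensor
module, and this is where `1 ≤ n` enters.

Symmetric polynomials are central in `AH_r`, and `f 1_{n,r}` is right multiplication by the central
element `f`, so it commutes with all endomorphisms (`polyOne_mem_center`). It acts on the summand
`P_r` as multiplication by `f`, which gives injectivity (`polyOne_injective`).

Conversely, a central `z` induces an endomorphism of the summand `P_r`. An endomorphism of `P_r`
is multiplication by the image `f` of `1`, and `f` is symmetric because `1` is fixed by the `s_i` and
`x_i - x_{i+1} - 1` is not a zero divisor (`exists_eq_mul_of_endomorphism`). Since `z` commutes with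
every endomorphism that factors through `P_r`, the difference `z - f 1_{n,r}` is killed by every
homomorphism from the tensor module to `P_r`. It remains to see that these homomorphisms separate
points (`IndMod.eq_zero_of_forall_apply_eq_zero`). A polynomial `g` that is symmetric in each block
of `c` defines a homomorphism with `m_c w ⊗ p ↦ p (g w)`, and every element of `M(c) ⊗ AH_r` is a
sum of tensors `y ⊗ p_y` with polynomials `p_y`. To leading order `g w` is the permuted polynomial
`w⁻¹ g`, so the top components of the `p_y` satisfy a linear relation between distinct characters of
the monoid of homogeneous block-symmetric polynomials. The sums of the variables in a block show
that these characters differ by non-zero-divisors, and Dedekind's argument makes the top components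
vanish.

The maps `m_c w ⊗ p ↦ p (g w)` require that the operators of the `s_i` define an action of the
symmetric group, that is, its Coxeter presentation (`exists_permHom`), and that a parabolic subgroup
is generated by the basic transpositions in it (`mem_closure_of_mem_parabolic`).
-/

noncomputable section

namespace DegAffSchur

/-! ### The Coxeter presentation of the symmetric group -/

theorem Simple.perm_left {r : ℕ} (i : Simple r) : i.perm i.left = i.right :=
  Equiv.swap_apply_left _ _

theorem Simple.perm_right {r : ℕ} (i : Simple r) : i.perm i.right = i.left :=
  Equiv.swap_apply_right _ _

theorem Simple.perm_of_ne {r : ℕ} (i : Simple r) {a : Fin r} (h : a ≠ i.left)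
    (h' : a ≠ i.right) : i.perm a = a :=
  Equiv.swap_apply_of_ne_of_ne h h'

theorem Simple.perm_mul_self {r : ℕ} (i : Simple r) : i.perm * i.perm = 1 :=
  Equiv.swap_mul_self _ _

theorem Simple.val_perm {r : ℕ} (i : Simple r) (a : Fin r) :
    (i.perm a : ℕ) = if a.1 = i.1 then i.1 + 1 else if a.1 = i.1 + 1 then i.1 else a.1 := by
  simp only [Simple.perm, Equiv.swap_apply_def, Fin.ext_iff, Simple.left, Simple.right]
  split_ifs <;> rfl

/-- The index `i` of a basic transposition of `S_r`. -/
def Simple.ofNat {r : ℕ} (i : ℕ) (h : i + 1 < r) : Simple r := ⟨i, h⟩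

@[simp]
theorem Simple.val_ofNat {r i : ℕ} (h : i + 1 < r) : (Simple.ofNat i h).1 = i := rfl

theorem Simple.perm_comm {r : ℕ} {i j : Simple r} (h : i.1 + 1 < j.1) :
    i.perm * j.perm = j.perm * i.perm := by
  ext a
  simp only [Equiv.Perm.mul_apply, Simple.val_perm]
  split_ifs <;> omega

theorem Simple.perm_braid {r : ℕ} {i j : Simple r} (h : i.1 + 1 = j.1) :
    i.perm * j.perm * i.perm = j.perm * i.perm * j.perm := by
  have h1 : j.left = i.right := Fin.ext h.symm
  have h2 : i.left ≠ j.right := by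
    simp only [ne_eq, Fin.ext_iff, Simple.left, Simple.right]
    omega
  have h3 := j.left_ne_right
  have h4 := i.left_ne_right
  rw [h1] at h3
  simp only [Simple.perm, h1]
  rw [Equiv.swap_mul_swap_mul_swap h4 h2, Equiv.swap_comm i.left, Equiv.swap_comm _ j.right,
    Equiv.swap_mul_swap_mul_swap h3.symm h2.symm, Equiv.swap_comm]

section Presentation

variable {H : Type*} [Group H]

/-- The product `t_{j+l-1} ⋯ t_{j+1} t_j` of `l` factors with descending indices. If the `t_i`
satisfy the Coxeter relations, the products with `j + l = m` represent the cosets of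
`⟨t_0, …, t_{m-2}⟩` in `⟨t_0, …, t_{m-1}⟩`. -/
def descProd (t : ℕ → H) (j : ℕ) : ℕ → H
  | 0 => 1
  | l + 1 => t (j + l) * descProd t j l

variable {t : ℕ → H} {r : ℕ}

theorem descProd_succ_mul (j l : ℕ) : descProd t (j + 1) l * t j = descProd t j (l + 1) := by
  induction l with
  | zero => simp [descProd]
  | succ l ih =>
    rw [descProd, mul_assoc, ih, show j + 1 + l = j + (l + 1) by omega]
    rfl

theorem descProd_mul_of_lt (hcomm : ∀ i j, i + 1 < j → j + 1 < r → t i * t j = t j * t i)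
    {i j l : ℕ} (hij : i + 1 < j) (hl : j + l < r) :
    descProd t j l * t i = t i * descProd t j l := by
  induction l with
  | zero => simp [descProd]
  | succ l ih =>
    rw [descProd, mul_assoc, ih (by omega), ← mul_assoc, ← mul_assoc,
      hcomm i (j + l) (by omega) (by omega)]

theorem descProd_mul_of_gt (hcomm : ∀ i j, i + 1 < j → j + 1 < r → t i * t j = t j * t i)
    {i j l : ℕ} (hij : j + l < i) (hi : i + 1 < r) :
    descProd t j l * t i = t i * descProd t j l := by
  induction l with
  | zero => simp [descProd]
  | succ l ih =>
    rw [descProd, mul_assoc, ih (by omega), ← mul_assoc, ← mul_assoc,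
      hcomm (j + l) i (by omega) (by omega)]

/-- A generator whose index lies strictly inside the range of a descending product passes
through it with its index lowered by one; this is the braid relation. -/
theorem descProd_mul_of_mem (hcomm : ∀ i j, i + 1 < j → j + 1 < r → t i * t j = t j * t i)
    (hbraid : ∀ i, i + 2 < r → t i * t (i + 1) * t i = t (i + 1) * t i * t (i + 1))
    {i j l : ℕ} (hij : j ≤ i) (hi : i + 1 < j + l) (hl : j + l < r) :
    descProd t j l * t (i + 1) = t i * descProd t j l := by
  induction l with
  | zero => omega
  | succ l ih =>
    by_cases h : i + 1 < j + l
    · rw [descProd, mul_assoc, ih h (by omega), ← mul_assoc, ← mul_assoc,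
        hcomm i (j + l) (by omega) (by omega)]
    · obtain ⟨d, rfl⟩ : ∃ d, l = d + 1 := ⟨l - 1, by omega⟩
      obtain rfl : i = j + d := by omega
      rw [descProd, descProd, mul_assoc, mul_assoc,
        descProd_mul_of_gt hcomm (by omega) (by omega), ← add_assoc, ← mul_assoc, ← mul_assoc,
        ← hbraid _ (by omega), mul_assoc, mul_assoc]

/-- The coset enumeration behind the Coxeter presentation: the products `descProd t j l` with
`j + l = m + 1` represent all cosets, because right multiplication by a generator permutes the
cosets they span. -/
theorem exists_mul_descProd (hsq : ∀ i, i + 1 < r → t i * t i = 1)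
    (hcomm : ∀ i j, i + 1 < j → j + 1 < r → t i * t j = t j * t i)
    (hbraid : ∀ i, i + 2 < r → t i * t (i + 1) * t i = t (i + 1) * t i * t (i + 1))
    {m : ℕ} (hm : m + 1 < r) {x : H} (hx : x ∈ Subgroup.closure (t '' Set.Iio (m + 1))) :
    ∃ u ∈ Subgroup.closure (t '' Set.Iio m), ∃ j l, j + l = m + 1 ∧ x = u * descProd t j l := by
  have step : ∀ x, (∃ u ∈ Subgroup.closure (t '' Set.Iio m), ∃ j l, j + l = m + 1 ∧
      x = u * descProd t j l) → ∀ i < m + 1, ∃ u ∈ Subgroup.closure (t '' Set.Iio m),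
      ∃ j l, j + l = m + 1 ∧ x * t i = u * descProd t j l := by
    rintro _ ⟨u, hu, j, l, hjl, rfl⟩ i hi
    have mem : ∀ i < m, t i ∈ Subgroup.closure (t '' Set.Iio m) := fun i hi =>
      Subgroup.subset_closure ⟨i, hi, rfl⟩
    rcases lt_trichotomy i j with h | rfl | h
    · by_cases h' : i + 1 = j
      · subst h'
        exact ⟨u, hu, i, l + 1, by omega, by rw [mul_assoc, descProd_succ_mul]⟩
      · refine ⟨u * t i, mul_mem hu (mem i (by omega)), j, l, hjl, ?_⟩
        rw [mul_assoc, descProd_mul_of_lt hcomm (by omega) (by omega), mul_assoc]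
    · obtain ⟨d, rfl⟩ : ∃ d, l = d + 1 := ⟨l - 1, by omega⟩
      refine ⟨u, hu, i + 1, d, by omega, ?_⟩
      rw [← descProd_succ_mul, mul_assoc, mul_assoc, hsq i (by omega), mul_one]
    · obtain ⟨d, rfl⟩ : ∃ d, i = d + 1 := ⟨i - 1, by omega⟩
      refine ⟨u * t d, mul_mem hu (mem d (by omega)), j, l, hjl, ?_⟩
      rw [mul_assoc, descProd_mul_of_mem hcomm hbraid (by omega) (by omega) (by omega),
        mul_assoc]
  induction hx using Subgroup.closure_induction_right with
  | one => exact ⟨1, one_mem _, m + 1, 0, rfl, by simp [descProd]⟩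
  | mul_right x hx y hy ih =>
    obtain ⟨i, hi, rfl⟩ := hy
    exact step x ih i hi
  | mul_inv_cancel x hx y hy ih =>
    obtain ⟨i, hi, rfl⟩ := hy
    have hi' : i < m + 1 := hi
    rw [inv_eq_of_mul_eq_one_right (hsq i (by omega))]
    exact step x ih i hi

/-- An element of a group generated by Coxeter generators is trivial if the permutation it
represents is. -/
theorem eq_one_of_perm_eq_one (hsq : ∀ i, i + 1 < r → t i * t i = 1)
    (hcomm : ∀ i j, i + 1 < j → j + 1 < r → t i * t j = t j * t i)
    (hbraid : ∀ i, i + 2 < r → t i * t (i + 1) * t i = t (i + 1) * t i * t (i + 1))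
    (p : H →* Equiv.Perm (Fin r)) (hp : ∀ i (h : i + 1 < r), p (t i) = (Simple.ofNat i h).perm)
    {m : ℕ} (hm : m < r) {x : H} (hx : x ∈ Subgroup.closure (t '' Set.Iio m)) (h1 : p x = 1) :
    x = 1 := by
  induction m generalizing x with
  | zero => simpa using hx
  | succ m ih =>
    obtain ⟨u, hu, j, l, hjl, rfl⟩ := exists_mul_descProd hsq hcomm hbraid hm hx
    have hdesc : ∀ l, j + l < r → ∀ a : Fin r, a.1 = j → (p (descProd t j l) a).1 = j + l := by
      intro l
      induction l with
      | zero => intro _ a ha; simpa [descProd] using ha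
      | succ l ih =>
        intro hl a ha
        rw [descProd, map_mul, hp _ (by omega), Equiv.Perm.mul_apply, Simple.val_perm,
          ih (by omega) a ha, Simple.val_ofNat, if_pos rfl, add_assoc]
    have hfix : ∀ u ∈ Subgroup.closure (t '' Set.Iio m), p u ⟨m + 1, hm⟩ = ⟨m + 1, hm⟩ := by
      intro u hu
      induction hu using Subgroup.closure_induction with
      | mem x hx =>
        obtain ⟨i, hi, rfl⟩ := hx
        have hi' : i < m := hi
        rw [hp i (by omega)]
        apply Simple.perm_of_ne <;> simp [Simple.left, Simple.right, Fin.ext_iff] <;> omega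
      | one => simp
      | mul x y _ _ hx hy => rw [map_mul, Equiv.Perm.mul_apply, hy, hx]
      | inv x _ hx => rw [map_inv, Equiv.Perm.inv_eq_iff_eq, hx]
    have h2 : p u (p (descProd t j l) ⟨j, by omega⟩) = ⟨j, by omega⟩ := by
      rw [← Equiv.Perm.mul_apply, ← map_mul, h1, Equiv.Perm.one_apply]
    have h3 : p (descProd t j l) ⟨j, by omega⟩ = ⟨m + 1, hm⟩ :=
      Fin.ext ((hdesc l (by omega) _ rfl).trans hjl)
    rw [h3, hfix u hu, Fin.mk.injEq] at h2
    obtain rfl : l = 0 := by omega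
    rw [descProd, mul_one] at h1 ⊢
    exact ih (by omega) hu h1

/-- The symmetric group is generated by the basic transpositions. -/
theorem closure_range_perm (r : ℕ) :
    Subgroup.closure (Set.range (Simple.perm (r := r))) = ⊤ := by
  cases r with
  | zero => exact Subsingleton.elim _ _
  | succ r =>
    rw [eq_top_iff, ← Subgroup.toSubmonoid_le, Subgroup.top_toSubmonoid,
      ← Equiv.Perm.mclosure_swap_castSucc_succ, Submonoid.closure_le]
    rintro _ ⟨i, rfl⟩
    exact Subgroup.subset_closure ⟨⟨i.1, by omega⟩, rfl⟩

/-- Every family satisfying the Coxeter relations extends to a homomorphism from the symmetric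
group. -/
theorem exists_permHom (t : Simple r → H) (hsq : ∀ i, t i * t i = 1)
    (hcomm : ∀ i j, i.1 + 1 < j.1 → t i * t j = t j * t i)
    (hbraid : ∀ i j, i.1 + 1 = j.1 → t i * t j * t i = t j * t i * t j) :
    ∃ f : Equiv.Perm (Fin r) →* H, ∀ i, f i.perm = t i := by
  -- The graph of the homomorphism is the subgroup generated by the pairs `(s_i, t_i)`.
  let G : Subgroup (Equiv.Perm (Fin r) × H) :=
    Subgroup.closure (Set.range fun i : Simple r => (i.perm, t i))
  let T : ℕ → Equiv.Perm (Fin r) × H := fun i =>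
    if h : i + 1 < r then ((Simple.ofNat i h).perm, t (Simple.ofNat i h)) else 1
  have hT : ∀ i (h : i + 1 < r), T i = ((Simple.ofNat i h).perm, t (Simple.ofNat i h)) :=
    fun i h => dif_pos h
  have hG : G ≤ Subgroup.closure (T '' Set.Iio (r - 1)) := by
    refine (Subgroup.closure_le _).2 ?_
    rintro _ ⟨i, rfl⟩
    have hi := i.2
    exact Subgroup.subset_closure ⟨i.1, by simp only [Set.mem_Iio]; omega, hT i.1 i.2⟩
  have inj : ∀ x ∈ G, x.1 = 1 → x = 1 := by
    intro x hx h1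
    rcases Nat.eq_zero_or_pos r with rfl | hr
    · have : T '' Set.Iio (0 - 1) = ∅ := by simp
      simpa [this] using hG hx
    · refine eq_one_of_perm_eq_one (t := T) ?_ ?_ ?_ (MonoidHom.fst _ _) ?_
        (Nat.sub_lt hr one_pos) (hG hx) h1
      · intro i h
        rw [hT i h, Prod.mk_mul_mk, hsq, Simple.perm_mul_self]; rfl
      · intro i j h h'
        rw [hT i (by omega), hT j h', Prod.mk_mul_mk, Prod.mk_mul_mk, hcomm _ _ h,
          Simple.perm_comm h]
      · intro i h
        rw [hT i (by omega), hT (i + 1) h]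
        simp only [Prod.mk_mul_mk]
        rw [hbraid (Simple.ofNat i (by omega)) (Simple.ofNat (i + 1) h) rfl,
          Simple.perm_braid (i := Simple.ofNat i (by omega)) (j := Simple.ofNat (i + 1) h) rfl]
      · intro i h
        rw [hT i h]; rfl
  let F : G →* Equiv.Perm (Fin r) := (MonoidHom.fst _ _).comp G.subtype
  have hFinj : Function.Injective F := by
    rw [injective_iff_map_eq_one]
    exact fun x hx => Subtype.ext (inj x.1 x.2 hx)
  have hFsurj : Function.Surjective F := by
    rw [← MonoidHom.range_eq_top, eq_top_iff, ← closure_range_perm, Subgroup.closure_le]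
    rintro _ ⟨i, rfl⟩
    exact ⟨⟨(i.perm, t i), Subgroup.subset_closure ⟨i, rfl⟩⟩, rfl⟩
  let E := MulEquiv.ofBijective F ⟨hFinj, hFsurj⟩
  refine ⟨((MonoidHom.snd _ _).comp G.subtype).comp E.symm.toMonoidHom, fun i => ?_⟩
  have : E.symm i.perm = ⟨(i.perm, t i), Subgroup.subset_closure ⟨i, rfl⟩⟩ := by
    rw [MulEquiv.symm_apply_eq]; rfl
  simp [this]

end Presentation

/-! ### Blocks of a composition and generation of its parabolic subgroup -/

section Blocks

variable {n r : ℕ} {c : Comp n r}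

theorem InBlock.le {b b' : Fin n} {j j' : Fin r} (h : InBlock c b j) (h' : InBlock c b' j')
    (hj : j ≤ j') : b ≤ b' := by
  by_contra hb
  have hsub : Finset.Iic b' ⊆ Finset.Iio b := fun a ha => by
    rw [Finset.mem_Iic] at ha
    exact Finset.mem_Iio.2 (ha.trans_lt (not_le.1 hb))
  have h1 := Finset.sum_le_sum_of_subset (f := c.1) hsub
  have h2 := h.1
  have h3 := h'.2
  have h4 : (j : ℕ) ≤ j' := hj
  omega

theorem exists_inBlock (c : Comp n r) (j : Fin r) : ∃ b, InBlock c b j := by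
  classical
  have hc := c.2
  have hj := j.2
  have hne : (Finset.univ.filter fun b => (j : ℕ) < ∑ a ∈ Finset.Iic b, c.1 a).Nonempty := by
    rcases n with _ | n
    · simp at hc; omega
    · refine ⟨Fin.last n, ?_⟩
      have : Finset.Iic (Fin.last n) = Finset.univ := by
        ext a; simp [Fin.le_last]
      simp only [Finset.mem_filter, Finset.mem_univ, true_and, this]
      omega
  obtain ⟨b, hb, hmin⟩ := Finset.exists_min_image _ id hne
  simp only [Finset.mem_filter, Finset.mem_univ, true_and, id] at hb hmin
  refine ⟨b, ?_, hb⟩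
  by_contra hlt
  rw [not_le] at hlt
  have hb0 : 0 < b.1 := by
    by_contra h0
    have : Finset.Iio b = ∅ := by
      ext a; simp only [Finset.mem_Iio, Finset.notMem_empty, iff_false, Fin.lt_def]; omega
    simp [this] at hlt
  have hI : Finset.Iio b = Finset.Iic ⟨b.1 - 1, by omega⟩ := by
    ext a; simp only [Finset.mem_Iio, Finset.mem_Iic, Fin.lt_def, Fin.le_def]; omega
  rw [hI] at hlt
  have := hmin _ hlt
  rw [Fin.le_def] at this
  simp only at this
  omega

theorem exists_descent {w : Equiv.Perm (Fin r)} (hw : w ≠ 1) :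
    ∃ i : Simple r, w i.right < w i.left := by
  by_contra! h
  apply hw
  rcases r with _ | r
  · exact Subsingleton.elim _ _
  · have hm : StrictMono w := Fin.strictMono_iff_lt_succ.2 fun i =>
      lt_of_le_of_ne (h ⟨i.1, by omega⟩) (w.injective.ne (Fin.castSucc_lt_succ).ne)
    have := Subsingleton.elim (hm.orderIsoOfSurjective w w.surjective) (OrderIso.refl _)
    ext a
    exact congrArg Fin.val (DFunLike.congr_fun this a)

theorem perm_mem_parabolic_of_descent {w : Equiv.Perm (Fin r)} (hw : w ∈ parabolic c)
    {i : Simple r} (hi : w i.right < w i.left) : i.perm ∈ parabolic c := by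
  obtain ⟨b, hb⟩ := exists_inBlock c i.left
  obtain ⟨b', hb'⟩ := exists_inBlock c i.right
  have hlr : i.left ≤ i.right := Nat.le_succ _
  obtain rfl : b = b' :=
    le_antisymm (hb.le hb' hlr) (((hw b' _).2 hb').le ((hw b _).2 hb) hi.le)
  have key : ∀ d, InBlock c d i.left ↔ InBlock c d i.right := fun d =>
    ⟨fun h => by rwa [le_antisymm (h.le hb le_rfl) (hb.le h le_rfl)],
      fun h => by rwa [le_antisymm (h.le hb' le_rfl) (hb'.le h le_rfl)]⟩
  intro d j
  by_cases h : j = i.left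
  · rw [h, Simple.perm_left, key]
  by_cases h' : j = i.right
  · rw [h', Simple.perm_right, key]
  rw [Simple.perm_of_ne i h h']

/-- A parabolic subgroup is generated by the basic transpositions it contains: undoing a descent
of a permutation that preserves the blocks stays inside a block. -/
theorem mem_closure_of_mem_parabolic {w : Equiv.Perm (Fin r)} (hw : w ∈ parabolic c) :
    w ∈ Subgroup.closure {v | ∃ i : Simple r, i.perm = v ∧ v ∈ parabolic c} := by
  -- Undoing a descent increases `∑ j, j * w j`, so the complementary sum is a decreasing measure.
  induction hN : ∑ j : Fin r, j.1 * (r - (w j).1) using Nat.strong_induction_on generalizing w with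
  | _ N ih =>
    by_cases h1 : w = 1
    · exact h1 ▸ one_mem _
    obtain ⟨i, hi⟩ := exists_descent h1
    have hip := perm_mem_parabolic_of_descent hw hi
    have hlt : ∑ j : Fin r, j.1 * (r - ((w * i.perm) j).1) < N := by
      rw [← hN, ← Equiv.sum_comp i.perm]
      have e : ∀ j : Fin r, (w * i.perm) (i.perm j) = w j := fun j => by
        rw [← Equiv.Perm.mul_apply, mul_assoc, Simple.perm_mul_self, mul_one]
      simp only [e]
      rw [← Finset.add_sum_erase _ _ (Finset.mem_univ i.left),
        ← Finset.add_sum_erase _ (fun j : Fin r => j.1 * (r - (w j).1)) (Finset.mem_univ i.left),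
        ← Finset.add_sum_erase _ _ (Finset.mem_erase.2 ⟨i.left_ne_right.symm, Finset.mem_univ _⟩),
        ← Finset.add_sum_erase _ (fun j : Fin r => j.1 * (r - (w j).1))
          (Finset.mem_erase.2 ⟨i.left_ne_right.symm, Finset.mem_univ _⟩)]
      rw [← add_assoc, ← add_assoc]
      refine add_lt_add_of_lt_of_le ?_ (Finset.sum_le_sum fun j hj => ?_)
      · rw [Simple.perm_left, Simple.perm_right]
        have hl := (w i.left).2
        have hi' : (w i.right).1 < (w i.left).1 := hi
        simp only [Simple.left, Simple.right] at hi' hl ⊢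
        rw [add_mul, add_mul]
        omega
      · simp only [Finset.mem_erase] at hj
        rw [Simple.perm_of_ne i hj.2.1 hj.1]
    have := mul_mem (ih _ hlt (mul_mem hw hip) rfl)
      (Subgroup.subset_closure
        (⟨i, rfl, hip⟩ : i.perm ∈ {v | ∃ i : Simple r, i.perm = v ∧ v ∈ parabolic c}))
    rwa [mul_assoc, Simple.perm_mul_self, mul_one] at this

end Blocks

/-! ### The polynomial module -/

section PolyModule

open MvPolynomial

/-- If `q` does not involve the variable `X_j`, then `X_j - q` is not a zero divisor. -/
theorem eq_zero_of_X_mul_eq_mul {σ R : Type*} [CommRing R] {j : σ} {q g : MvPolynomial σ R}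
    (hq : q.degreeOf j = 0) (h : X j * g = q * g) : g = 0 := by
  by_contra hg
  have h1 := (degreeOf_mul_X_eq_degreeOf_add_one_iff j g).2 hg
  have h2 := degreeOf_mul_le j q g
  rw [← h, mul_comm, h1, hq] at h2
  omega

variable {k : Type*} [CommRing k] {r : ℕ}

theorem X_sub_X_mul_cancel {i j : Fin r} (hij : i ≠ j) {g g' : MvPolynomial (Fin r) k}
    (h : (X i - X j) * g = (X i - X j) * g') : g = g' := by
  rw [← sub_eq_zero]
  apply AH.eq_zero_of_X_mul_eq hij
  linear_combination h

/-- The Demazure operator `∂_i f = (f - s_i f) / (x_i - x_{i+1})`. -/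
def demazure (i : Simple r) : MvPolynomial (Fin r) k →ₗ[k] MvPolynomial (Fin r) k where
  toFun f := (AH.exists_demazure i f).choose
  map_add' f g := by
    apply X_sub_X_mul_cancel i.left_ne_right
    rw [mul_add, (AH.exists_demazure i f).choose_spec.1, (AH.exists_demazure i g).choose_spec.1,
      (AH.exists_demazure i (f + g)).choose_spec.1, map_add]
    ring
  map_smul' a f := by
    apply X_sub_X_mul_cancel i.left_ne_right
    rw [RingHom.id_apply, mul_smul_comm, (AH.exists_demazure i f).choose_spec.1,
      (AH.exists_demazure i (a • f)).choose_spec.1, map_smul, smul_sub]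

theorem X_sub_X_mul_demazure (i : Simple r) (f : MvPolynomial (Fin r) k) :
    (X i.left - X i.right) * demazure i f = f - rename i.perm f :=
  (AH.exists_demazure i f).choose_spec.1

theorem s_mul_ofPoly_eq (i : Simple r) (f : MvPolynomial (Fin r) k) :
    AH.s k r i * AH.ofPoly k r f
      = AH.ofPoly k r (rename i.perm f) * AH.s k r i + AH.ofPoly k r (demazure i f) :=
  (AH.exists_demazure i f).choose_spec.2

theorem demazure_eq_iff (i : Simple r) {f g : MvPolynomial (Fin r) k} :
    demazure i f = g ↔ (X i.left - X i.right) * g = f - rename i.perm f := by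
  rw [← X_sub_X_mul_demazure]
  exact ⟨fun h => by rw [h], fun h => (X_sub_X_mul_cancel i.left_ne_right h).symm⟩

theorem rename_perm_rename_perm (i : Simple r) (f : MvPolynomial (Fin r) k) :
    rename i.perm (rename i.perm f) = f := by
  rw [rename_rename, ← Equiv.Perm.coe_mul, Simple.perm_mul_self, Equiv.Perm.coe_one,
    rename_id_apply]

theorem demazure_rename (i : Simple r) (f : MvPolynomial (Fin r) k) :
    demazure i (rename i.perm f) = -demazure i f := by
  rw [demazure_eq_iff, rename_perm_rename_perm, mul_neg, X_sub_X_mul_demazure, neg_sub]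

theorem demazure_eq_zero {i : Simple r} {f : MvPolynomial (Fin r) k} (h : rename i.perm f = f) :
    demazure i f = 0 := by
  rw [demazure_eq_iff, h, mul_zero, sub_self]

theorem demazure_mul (i : Simple r) (f g : MvPolynomial (Fin r) k) :
    demazure i (f * g) = rename i.perm f * demazure i g + demazure i f * g := by
  rw [demazure_eq_iff, map_mul]
  linear_combination rename i.perm f * X_sub_X_mul_demazure i g + g * X_sub_X_mul_demazure i f

/-- The coefficient `∂_i x_a`. -/
def delta (k : Type*) [CommRing k] {r : ℕ} (i : Simple r) (a : Fin r) : k :=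
  if a.1 = i.1 then 1 else if a.1 = i.1 + 1 then -1 else 0

theorem delta_left (i : Simple r) : delta k i i.left = 1 := if_pos rfl

theorem delta_right (i : Simple r) : delta k i i.right = -1 := by
  simp [delta, Simple.right]

theorem delta_of_ne {i : Simple r} {a : Fin r} (h : a ≠ i.left) (h' : a ≠ i.right) :
    delta k i a = 0 := by
  have h1 : a.1 ≠ i.1 := fun e => h (Fin.ext e)
  have h2 : a.1 ≠ i.1 + 1 := fun e => h' (Fin.ext e)
  simp [delta, h1, h2]

theorem demazure_X (i : Simple r) (a : Fin r) :
    demazure i (X a) = C (delta k i a) := by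
  rw [demazure_eq_iff, rename_X]
  by_cases h : a = i.left
  · rw [h, Simple.perm_left, delta_left, C_1, mul_one]
  by_cases h' : a = i.right
  · rw [h', Simple.perm_right, delta_right, C_neg, C_1]
    ring
  rw [Simple.perm_of_ne i h h', delta_of_ne h h', C_0, mul_zero, sub_self]

/-- The right action of `s_i` on polynomials, `g ↦ s_i g + ∂_i g`. It comes from the commutation
rule `g s_i = s_i (s_i g) + ∂_i g` in `AH_r` by letting `s_i` act trivially from the left. -/
def heckeOp (i : Simple r) : MvPolynomial (Fin r) k →ₗ[k] MvPolynomial (Fin r) k :=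
  (rename i.perm).toLinearMap + demazure i

theorem heckeOp_apply (i : Simple r) (g : MvPolynomial (Fin r) k) :
    heckeOp i g = rename i.perm g + demazure i g := rfl

theorem heckeOp_mul (i : Simple r) (f g : MvPolynomial (Fin r) k) :
    heckeOp i (f * g) = rename i.perm f * heckeOp i g + demazure i f * g := by
  rw [heckeOp_apply, heckeOp_apply, demazure_mul, map_mul]
  ring

theorem heckeOp_mul_X (i : Simple r) (a : Fin r) (g : MvPolynomial (Fin r) k) :
    heckeOp i (g * X a) = heckeOp i g * X (i.perm a) + delta k i a • g := by
  rw [mul_comm, heckeOp_mul, rename_X, demazure_X, C_mul', mul_comm]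

theorem heckeOp_eq_self {i : Simple r} {g : MvPolynomial (Fin r) k} (h : rename i.perm g = g) :
    heckeOp i g = g := by
  rw [heckeOp_apply, demazure_eq_zero h, h, add_zero]

theorem heckeOp_C (i : Simple r) (a : k) :
    heckeOp i (C a : MvPolynomial (Fin r) k) = C a :=
  heckeOp_eq_self (rename_C _ _)

/-- Here it matters that `x_i - x_{i+1} - 1` is not a zero divisor. -/
theorem rename_eq_self_of_heckeOp_eq_self {i : Simple r} {g : MvPolynomial (Fin r) k}
    (h : heckeOp i g = g) : rename i.perm g = g := by
  have h1 := X_sub_X_mul_demazure i g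
  rw [heckeOp_apply] at h
  have h0 : demazure i g = 0 := by
    refine eq_zero_of_X_mul_eq_mul (j := i.left) (q := X i.right + C 1) ?_ ?_
    · refine Nat.le_zero.1 ((degreeOf_add_le _ _ _).trans ?_)
      rw [degreeOf_C]
      by_cases hk : Nontrivial k
      · simp [degreeOf_X, i.left_ne_right]
      · rw [not_nontrivial_iff_subsingleton] at hk
        simp [Subsingleton.elim (X i.right : MvPolynomial (Fin r) k) 0]
    · rw [C_1]
      linear_combination h1 - h
  rwa [h0, add_zero] at h

theorem delta_perm (i : Simple r) (a : Fin r) : delta k i (i.perm a) = -delta k i a := by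
  simp only [delta, Simple.val_perm]
  split_ifs <;> first | omega | simp

theorem delta_perm_of_lt {i j : Simple r} (h : i.1 + 1 < j.1) (a : Fin r) :
    delta k i (j.perm a) = delta k i a ∧ delta k j (i.perm a) = delta k j a := by
  simp only [delta, Simple.val_perm]
  constructor <;> split_ifs <;> first | omega | rfl

theorem delta_braid {i j : Simple r} (h : i.1 + 1 = j.1) (a : Fin r) :
    delta k i (j.perm (i.perm a)) = delta k j a ∧
      delta k j (i.perm (j.perm a)) = delta k i a ∧
      delta k j (i.perm a) = delta k i (j.perm a) := by
  have h1 := Simple.val_perm i a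
  have h2 := Simple.val_perm j a
  have h3 := Simple.val_perm j (i.perm a)
  have h4 := Simple.val_perm i (j.perm a)
  simp only [delta]
  generalize ((j.perm (i.perm a)) : ℕ) = c at *
  generalize ((i.perm (j.perm a)) : ℕ) = d at *
  generalize ((i.perm a) : ℕ) = e at *
  generalize ((j.perm a) : ℕ) = f at *
  split_ifs at h1 <;> split_ifs at h2 <;> split_ifs at h3 <;> split_ifs at h4 <;>
    first | omega | skip
  all_goals subst h1 h2 h3 h4
  all_goals refine ⟨?_, ?_, ?_⟩ <;> split_ifs <;> first | omega | rfl

theorem heckeOp_heckeOp (i : Simple r) (g : MvPolynomial (Fin r) k) :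
    heckeOp i (heckeOp i g) = g := by
  induction g using MvPolynomial.induction_on with
  | C a => rw [heckeOp_C, heckeOp_C]
  | add p q hp hq => rw [map_add, map_add, hp, hq]
  | mul_X p a hp =>
    rw [heckeOp_mul_X, map_add, map_smul, heckeOp_mul_X, hp, ← Equiv.Perm.mul_apply,
      Simple.perm_mul_self, delta_perm, Equiv.Perm.one_apply]
    module

theorem heckeOp_comm {i j : Simple r} (h : i.1 + 1 < j.1) (g : MvPolynomial (Fin r) k) :
    heckeOp i (heckeOp j g) = heckeOp j (heckeOp i g) := by
  induction g using MvPolynomial.induction_on with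
  | C a => simp only [heckeOp_C]
  | add p q hp hq => simp only [map_add, hp, hq]
  | mul_X p a hp =>
    simp only [heckeOp_mul_X, map_add, map_smul, hp, delta_perm_of_lt h]
    rw [← Equiv.Perm.mul_apply, Simple.perm_comm h, Equiv.Perm.mul_apply]
    module

/-- Both sides pass multiplication by a variable in the same way, with the same lower terms. -/
theorem heckeOp_braid {i j : Simple r} (h : i.1 + 1 = j.1) (g : MvPolynomial (Fin r) k) :
    heckeOp i (heckeOp j (heckeOp i g)) = heckeOp j (heckeOp i (heckeOp j g)) := by
  induction g using MvPolynomial.induction_on with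
  | C a => simp only [heckeOp_C]
  | add p q hp hq => simp only [map_add, hp, hq]
  | mul_X p a hp =>
    obtain ⟨h1, h2, h3⟩ := delta_braid (k := k) h a
    simp only [heckeOp_mul_X, map_add, map_smul, hp, h1, h2, h3, heckeOp_heckeOp]
    have h4 := congrArg (fun w : Equiv.Perm (Fin r) => w a) (Simple.perm_braid h)
    simp only [Equiv.Perm.mul_apply] at h4
    rw [h4]
    module

variable (k r)

/-- The operators by which the generators of `AH_r` act on polynomials from the right. -/
def genOp : Gen r → Module.End k (MvPolynomial (Fin r) k)
  | Gen.x i => LinearMap.mulLeft k (X i)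
  | Gen.s i => heckeOp i

/-- The right action of the free algebra on polynomials, as a homomorphism to the opposite of the
endomorphism algebra. -/
def freeRep : FreeAlgebra k (Gen r) →ₐ[k] (Module.End k (MvPolynomial (Fin r) k))ᵐᵒᵖ :=
  FreeAlgebra.lift k fun g => MulOpposite.op (genOp k r g)

variable {k r}

theorem freeRep_mul (a b : FreeAlgebra k (Gen r)) (g : MvPolynomial (Fin r) k) :
    (freeRep k r (a * b)).unop g = (freeRep k r b).unop ((freeRep k r a).unop g) := by
  rw [map_mul]; rfl

theorem freeRep_add (a b : FreeAlgebra k (Gen r)) (g : MvPolynomial (Fin r) k) :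
    (freeRep k r (a + b)).unop g = (freeRep k r a).unop g + (freeRep k r b).unop g := by
  rw [map_add]; rfl

theorem freeRep_one (g : MvPolynomial (Fin r) k) : (freeRep k r 1).unop g = g := by
  rw [map_one]; rfl

theorem freeRep_x (i : Fin r) (g : MvPolynomial (Fin r) k) :
    (freeRep k r (fx k r i)).unop g = g * X i := by
  rw [freeRep, FreeAlgebra.lift_ι_apply, mul_comm]; rfl

theorem freeRep_s (i : Simple r) (g : MvPolynomial (Fin r) k) :
    (freeRep k r (fs k r i)).unop g = heckeOp i g := by
  rw [freeRep, FreeAlgebra.lift_ι_apply]; rfl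

/-- The polynomial operators satisfy the defining relations of `AH_r`. -/
theorem freeRep_eq_of_rel {a b : FreeAlgebra k (Gen r)} (hab : HeckeRel k r a b) :
    freeRep k r a = freeRep k r b := by
  refine MulOpposite.unop_injective (LinearMap.ext fun g => ?_)
  induction hab with
  | x_comm i j => simp only [freeRep_mul, freeRep_x]; ring
  | s_sq i => simp only [freeRep_mul, freeRep_s, freeRep_one, heckeOp_heckeOp]
  | s_comm i j h => simp only [freeRep_mul, freeRep_s, heckeOp_comm h]
  | s_braid i j h => simp only [freeRep_mul, freeRep_s, heckeOp_braid h]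
  | s_x i =>
    simp only [freeRep_mul, freeRep_add, freeRep_one, freeRep_s, freeRep_x, heckeOp_mul_X,
      Simple.perm_right, delta_right]
    module
  | x_s i =>
    simp only [freeRep_mul, freeRep_add, freeRep_one, freeRep_s, freeRep_x, heckeOp_mul_X,
      Simple.perm_left, delta_left]
    module
  | x_s_comm i j h h' =>
    simp only [freeRep_mul, freeRep_s, freeRep_x, heckeOp_mul_X, Simple.perm_of_ne j h h',
      delta_of_ne h h', zero_smul, add_zero]

variable (k r)

/-- The right action of `AH_r` on `P_r`, as a homomorphism to the opposite of the endomorphism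
algebra. -/
def polyRep : AH k r →ₐ[k] (Module.End k (MvPolynomial (Fin r) k))ᵐᵒᵖ :=
  RingQuot.liftAlgHom k ⟨freeRep k r, fun _ _ => freeRep_eq_of_rel⟩

variable {k r}

theorem polyRep_proj (a : FreeAlgebra k (Gen r)) :
    polyRep k r (AH.proj k r a) = freeRep k r a :=
  RingQuot.liftAlgHom_mkAlgHom_apply _ _ _ _

/-- The polynomial algebra as a right `AH_r`-module: `x_i` acts by multiplication and `s_i` by
`heckeOp i`. It is isomorphic to the module induced from the trivial representation of `S_r`. -/
instance polyModule : Module (AH k r)ᵐᵒᵖ (MvPolynomial (Fin r) k) :=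
  Module.compHom _ ((RingEquiv.opOp _).symm.toRingHom.comp (polyRep k r).toRingHom.op :
    (AH k r)ᵐᵒᵖ →+* Module.End k (MvPolynomial (Fin r) k))

theorem op_smul_eq (h : AH k r) (g : MvPolynomial (Fin r) k) :
    MulOpposite.op h • g = (polyRep k r h).unop g := rfl

theorem op_s_smul (i : Simple r) (g : MvPolynomial (Fin r) k) :
    MulOpposite.op (AH.s k r i) • g = heckeOp i g := by
  rw [op_smul_eq, AH.s, polyRep_proj, freeRep_s]

theorem op_x_smul (i : Fin r) (g : MvPolynomial (Fin r) k) :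
    MulOpposite.op (AH.x k r i) • g = X i * g := by
  rw [op_smul_eq, AH.x, polyRep_proj, freeRep_x, mul_comm]

theorem op_algebraMap_smul (a : k) (g : MvPolynomial (Fin r) k) :
    MulOpposite.op (algebraMap k (AH k r) a) • g = a • g := by
  rw [op_smul_eq, AlgHom.commutes]
  rfl

theorem ofPoly_C (a : k) : AH.ofPoly k r (C a) = algebraMap k (AH k r) a :=
  (AH.ofPoly k r).commutes a

theorem op_ofPoly_smul (f g : MvPolynomial (Fin r) k) :
    MulOpposite.op (AH.ofPoly k r f) • g = f * g := by
  induction f using MvPolynomial.induction_on with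
  | C a => rw [ofPoly_C, op_algebraMap_smul, C_mul']
  | add p q hp hq => rw [map_add, MulOpposite.op_add, add_smul, hp, hq, add_mul]
  | mul_X p j hp =>
    rw [map_mul, MulOpposite.op_mul, mul_smul, hp, AH.ofPoly_X, op_x_smul]
    ring

/-- Induction over the generators of `AH_r`. -/
theorem AH.induction {p : AH k r → Prop} (hC : ∀ a, p (algebraMap k _ a))
    (hx : ∀ i, p (AH.x k r i)) (hs : ∀ i, p (AH.s k r i))
    (hadd : ∀ a b, p a → p b → p (a + b)) (hmul : ∀ a b, p a → p b → p (a * b))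
    (a : AH k r) : p a := by
  obtain ⟨a, rfl⟩ : ∃ b, AH.proj k r b = a := RingQuot.mkAlgHom_surjective k (HeckeRel k r) a
  induction a using FreeAlgebra.induction with
  | grade0 a => simpa using hC a
  | grade1 g => cases g with
    | x i => exact hx i
    | s i => exact hs i
  | mul a b ha hb => rw [map_mul]; exact hmul _ _ ha hb
  | add a b ha hb => rw [map_add]; exact hadd _ _ ha hb

/-- Symmetric polynomials are central in `AH_r`. -/
theorem ofPoly_mul_comm {f : MvPolynomial (Fin r) k} (hf : f.IsSymmetric) (a : AH k r) :
    AH.ofPoly k r f * a = a * AH.ofPoly k r f := by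
  induction a using AH.induction with
  | hC a => exact (Algebra.commutes a _).symm
  | hx i => rw [← AH.ofPoly_X, ← map_mul, ← map_mul, mul_comm]
  | hs i => exact (AH.s_mul_ofPoly i hf).symm
  | hadd a b ha hb => rw [mul_add, add_mul, ha, hb]
  | hmul a b ha hb => rw [← mul_assoc, ha, mul_assoc, hb, mul_assoc]

end PolyModule

open MvPolynomial

/-! ### The induced modules -/

section InducedModules

variable {k : Type*} [CommRing k] {n r : ℕ} {c : Comp n r}

instance (c : Comp n r) : Finite (Coset c) :=
  inferInstanceAs (Finite (Quotient (QuotientGroup.rightRel (parabolic c))))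

theorem Coset.act_mk (w g : Equiv.Perm (Fin r)) : (Coset.mk c g).act w = Coset.mk c (g * w) := rfl

theorem Coset.mk_eq_mk {v w : Equiv.Perm (Fin r)} :
    Coset.mk c v = Coset.mk c w ↔ w * v⁻¹ ∈ parabolic c := by
  rw [← QuotientGroup.rightRel_apply]
  exact Quotient.eq''

theorem Coset.exists_mk (y : Coset c) : ∃ w, Coset.mk c w = y := Quotient.exists_rep y

theorem IndMod.tmul_add (y : Coset c) (a b : AH k r) :
    IndMod.tmul k y (a + b) = IndMod.tmul k y a + IndMod.tmul k y b := by
  rw [IndMod.tmul, Finsupp.single_add]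
  rfl

theorem IndMod.op_smul_tmul (y : Coset c) (a b : AH k r) :
    MulOpposite.op b • IndMod.tmul k y a = IndMod.tmul k y (a * b) := by
  have : Finsupp.single y (a * b) = MulOpposite.op b • Finsupp.single y a := by
    rw [Finsupp.smul_single]; rfl
  rw [IndMod.tmul, IndMod.tmul, this]
  rfl

theorem IndMod.tmul_act (y : Coset c) (i : Simple r) (a : AH k r) :
    IndMod.tmul k (y.act i.perm) a = IndMod.tmul k y (AH.s k r i * a) :=
  (Submodule.Quotient.eq _).2 (Submodule.subset_span ⟨(y, i, a), rfl⟩)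

theorem IndMod.induction {p : IndMod k c → Prop} (h0 : p 0) (hadd : ∀ u v, p u → p v → p (u + v))
    (htmul : ∀ y a, p (IndMod.tmul k y a)) (v : IndMod k c) : p v := by
  obtain ⟨v, rfl⟩ := Submodule.Quotient.mk_surjective _ v
  induction v using Finsupp.induction_linear with
  | zero => exact h0
  | add u v hu hv => exact hadd _ _ hu hv
  | single y a => exact htmul y a

/-- The universal property of `M(c) ⊗_{k S_r} AH_r`: a map on the standard basis of `M(c)` that is
compatible with the basic transpositions extends to a homomorphism of right `AH_r`-modules. -/
def IndMod.lift {N : Type*} [AddCommGroup N] [Module (AH k r)ᵐᵒᵖ N] (f : Coset c → N)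
    (hf : ∀ y (i : Simple r), f (y.act i.perm) = MulOpposite.op (AH.s k r i) • f y) :
    IndMod k c →ₗ[(AH k r)ᵐᵒᵖ] N :=
  (balance k c).liftQ
    (Finsupp.lsum ℕ fun y =>
      { toFun := fun a => MulOpposite.op a • f y
        map_add' := fun a b => by rw [MulOpposite.op_add, add_smul]
        map_smul' := fun b a => by
          rw [RingHom.id_apply, ← mul_smul]
          rfl })
    (by
      rw [balance, Submodule.span_le]
      rintro _ ⟨⟨y, i, a⟩, rfl⟩
      rw [SetLike.mem_coe, LinearMap.mem_ker, map_sub, Finsupp.lsum_single, Finsupp.lsum_single]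
      change MulOpposite.op a • f _ - MulOpposite.op (_ * a) • f y = 0
      rw [hf, MulOpposite.op_mul, mul_smul, sub_self])

theorem IndMod.lift_tmul {N : Type*} [AddCommGroup N] [Module (AH k r)ᵐᵒᵖ N] (f : Coset c → N)
    (hf : ∀ y (i : Simple r), f (y.act i.perm) = MulOpposite.op (AH.s k r i) • f y)
    (y : Coset c) (a : AH k r) :
    IndMod.lift f hf (IndMod.tmul k y a) = MulOpposite.op a • f y := by
  refine (Submodule.liftQ_apply _ _ _).trans ?_
  rw [Finsupp.lsum_single]
  rfl

theorem ofPoly_mul_s (i : Simple r) (f : MvPolynomial (Fin r) k) :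
    AH.ofPoly k r f * AH.s k r i
      = AH.s k r i * AH.ofPoly k r (rename i.perm f) + AH.ofPoly k r (demazure i f) := by
  rw [s_mul_ofPoly_eq, rename_perm_rename_perm, demazure_rename, map_neg, neg_add_cancel_right]

/-- Every element of `M(c) ⊗_{k S_r} AH_r` is a sum of tensors `y ⊗ p_y` with polynomials `p_y`. -/
theorem IndMod.exists_eq_sum [Fintype (Coset c)] (v : IndMod k c) :
    ∃ p : Coset c → MvPolynomial (Fin r) k,
      v = ∑ y, IndMod.tmul k y (AH.ofPoly k r (p y)) := by
  classical
  let S : AddSubmonoid (IndMod k c) := AddSubmonoid.closure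
    (Set.range fun t : Coset c × MvPolynomial (Fin r) k => IndMod.tmul k t.1 (AH.ofPoly k r t.2))
  have mem : ∀ y p, IndMod.tmul k y (AH.ofPoly k r p) ∈ S := fun y p =>
    AddSubmonoid.subset_closure ⟨(y, p), rfl⟩
  have extend : ∀ a : AH k r, (∀ y p, MulOpposite.op a • IndMod.tmul k y (AH.ofPoly k r p) ∈ S) →
      ∀ v ∈ S, MulOpposite.op a • v ∈ S := by
    intro a ha v hv
    induction hv using AddSubmonoid.closure_induction with
    | mem x hx =>
      obtain ⟨⟨y, p⟩, rfl⟩ := hx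
      exact ha y p
    | zero => rw [smul_zero]; exact zero_mem _
    | add u v _ _ hu hv => rw [smul_add]; exact add_mem hu hv
  have stable : ∀ a : AH k r, ∀ v ∈ S, MulOpposite.op a • v ∈ S := by
    intro a
    induction a using AH.induction with
    | hC a =>
      refine extend _ fun y p => ?_
      rw [IndMod.op_smul_tmul, ← ofPoly_C, ← map_mul]
      exact mem _ _
    | hx i =>
      refine extend _ fun y p => ?_
      rw [IndMod.op_smul_tmul, ← AH.ofPoly_X, ← map_mul]
      exact mem _ _
    | hs i =>
      refine extend _ fun y p => ?_
      rw [IndMod.op_smul_tmul, ofPoly_mul_s, IndMod.tmul_add, ← IndMod.tmul_act]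
      exact add_mem (mem _ _) (mem _ _)
    | hadd a b ha hb =>
      intro v hv
      rw [MulOpposite.op_add, add_smul]
      exact add_mem (ha v hv) (hb v hv)
    | hmul a b ha hb =>
      intro v hv
      rw [MulOpposite.op_mul, mul_smul]
      exact hb _ (ha v hv)
  have all : v ∈ S := by
    induction v using IndMod.induction with
    | h0 => exact zero_mem _
    | hadd u v hu hv => exact add_mem hu hv
    | htmul y a =>
      have := stable a _ (mem y 1)
      rwa [map_one, IndMod.op_smul_tmul, one_mul] at this
  have tmul_zero : ∀ y : Coset c, IndMod.tmul k y 0 = 0 := fun y => by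
    rw [IndMod.tmul, Finsupp.single_zero]; rfl
  change v ∈ AddSubmonoid.closure _ at all
  induction all using AddSubmonoid.closure_induction with
  | mem x hx =>
    obtain ⟨⟨y, p⟩, rfl⟩ := hx
    refine ⟨Pi.single y p, ?_⟩
    rw [Finset.sum_eq_single y]
    · rw [Pi.single_eq_same]
    · intro z _ hz
      rw [Pi.single_eq_of_ne hz, map_zero, tmul_zero]
    · exact fun h => (h (Finset.mem_univ _)).elim
  | zero => exact ⟨0, by simp [tmul_zero]⟩
  | add u v _ _ hu hv =>
    obtain ⟨p, rfl⟩ := hu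
    obtain ⟨q, rfl⟩ := hv
    exact ⟨p + q, by simp [IndMod.tmul_add, Finset.sum_add_distrib]⟩

end InducedModules

/-! ### Homomorphisms to the polynomial module -/

section Separation

variable {k : Type*} [CommRing k] {n r : ℕ} {c : Comp n r}

theorem AH.s_mul_self (i : Simple r) : AH.s k r i * AH.s k r i = 1 := by
  simpa [AH.s] using AH.proj_rel (HeckeRel.s_sq (k := k) i)

theorem AH.s_comm {i j : Simple r} (h : i.1 + 1 < j.1) :
    AH.s k r i * AH.s k r j = AH.s k r j * AH.s k r i := by
  simpa [AH.s] using AH.proj_rel (HeckeRel.s_comm (k := k) i j h)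

theorem AH.s_braid {i j : Simple r} (h : i.1 + 1 = j.1) :
    AH.s k r i * AH.s k r j * AH.s k r i = AH.s k r j * AH.s k r i * AH.s k r j := by
  simpa [AH.s] using AH.proj_rel (HeckeRel.s_braid (k := k) i j h)

/-- The generator `s_i` as a unit of `AH_r`. -/
def sUnit (k : Type*) [CommRing k] {r : ℕ} (i : Simple r) : (AH k r)ˣ :=
  ⟨AH.s k r i, AH.s k r i, AH.s_mul_self i, AH.s_mul_self i⟩

theorem exists_permUnit (k : Type*) [CommRing k] (r : ℕ) :
    ∃ f : Equiv.Perm (Fin r) →* (AH k r)ˣ, ∀ i : Simple r, f i.perm = sUnit k i := by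
  exact exists_permHom _ (fun i => Units.ext (AH.s_mul_self i))
    (fun i j h => Units.ext (AH.s_comm h)) (fun i j h => Units.ext (AH.s_braid h))

/-- The homomorphism from the symmetric group to the units of `AH_r`. -/
def permUnit (k : Type*) [CommRing k] (r : ℕ) : Equiv.Perm (Fin r) →* (AH k r)ˣ :=
  (exists_permUnit k r).choose

theorem permUnit_perm (i : Simple r) : (permUnit k r i.perm : AH k r) = AH.s k r i := by
  rw [permUnit, (exists_permUnit k r).choose_spec]; rfl

/-- The right action of the symmetric group on polynomials that extends the operators
`heckeOp i`. -/
def permOp (w : Equiv.Perm (Fin r)) (g : MvPolynomial (Fin r) k) : MvPolynomial (Fin r) k :=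
  MulOpposite.op (permUnit k r w : AH k r) • g

theorem permOp_mul (v w : Equiv.Perm (Fin r)) (g : MvPolynomial (Fin r) k) :
    permOp (v * w) g = permOp w (permOp v g) := by
  rw [permOp, map_mul, Units.val_mul, MulOpposite.op_mul, mul_smul]; rfl

theorem permOp_one (g : MvPolynomial (Fin r) k) : permOp 1 g = g := by
  rw [permOp, map_one, Units.val_one, MulOpposite.op_one, one_smul]

theorem permOp_perm (i : Simple r) (g : MvPolynomial (Fin r) k) :
    permOp i.perm g = heckeOp i g := by
  rw [permOp, permUnit_perm, op_s_smul]

theorem permOp_eq_self {g : MvPolynomial (Fin r) k} (hg : ∀ w ∈ parabolic c, rename w g = g)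
    {w : Equiv.Perm (Fin r)} (hw : w ∈ parabolic c) : permOp w g = g := by
  replace hw := mem_closure_of_mem_parabolic hw
  induction hw using Subgroup.closure_induction with
  | mem v hv =>
    obtain ⟨i, rfl, hi⟩ := hv
    rw [permOp_perm, heckeOp_eq_self (hg _ hi)]
  | one => exact permOp_one g
  | mul v w _ _ hv hw => rw [permOp_mul, hv, hw]
  | inv v _ hv =>
    conv_lhs => rw [← hv]
    rw [← permOp_mul, mul_inv_cancel, permOp_one]

/-- For a polynomial `g` that is symmetric in the variables of each block of `c`, the map on right
cosets with `S_c w ↦ g w`. -/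
def cosetOrbit (c : Comp n r) (g : MvPolynomial (Fin r) k)
    (hg : ∀ w ∈ parabolic c, rename w g = g) (y : Coset c) : MvPolynomial (Fin r) k :=
  Quotient.lift (s := QuotientGroup.rightRel (parabolic c)) (fun w => permOp w g) (by
    intro v w h
    have h' : w * v⁻¹ ∈ parabolic c := QuotientGroup.rightRel_apply.1 h
    have : w = w * v⁻¹ * v := by group
    change permOp v g = permOp w g
    rw [this, permOp_mul, permOp_eq_self hg h']) y

theorem cosetOrbit_mk {g : MvPolynomial (Fin r) k} (hg : ∀ w ∈ parabolic c, rename w g = g)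
    (w : Equiv.Perm (Fin r)) : cosetOrbit c g hg (Coset.mk c w) = permOp w g := rfl

/-- For a polynomial `g` that is symmetric in the variables of each block of `c`, the homomorphism
`M(c) ⊗ AH_r → P_r` with `m_c ⊗ 1 ↦ g`. -/
def blockMap (c : Comp n r) (g : MvPolynomial (Fin r) k)
    (hg : ∀ w ∈ parabolic c, rename w g = g) :
    IndMod k c →ₗ[(AH k r)ᵐᵒᵖ] MvPolynomial (Fin r) k :=
  IndMod.lift (cosetOrbit c g hg) (by
    intro y i
    obtain ⟨w, rfl⟩ := y.exists_mk
    rw [op_s_smul, ← permOp_perm, Coset.act_mk, cosetOrbit_mk, cosetOrbit_mk, permOp_mul])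

theorem blockMap_tmul {g : MvPolynomial (Fin r) k}
    (hg : ∀ w ∈ parabolic c, rename w g = g) (w : Equiv.Perm (Fin r))
    (p : MvPolynomial (Fin r) k) :
    blockMap c g hg (IndMod.tmul k (Coset.mk c w) (AH.ofPoly k r p)) = p * permOp w g := by
  rw [blockMap, IndMod.lift_tmul, op_ofPoly_smul, cosetOrbit_mk]

/-! ### Leading terms -/

theorem homogeneousComponent_X_mul (a : Fin r) (m : ℕ) (q : MvPolynomial (Fin r) k) :
    homogeneousComponent (m + 1) (X a * q) = X a * homogeneousComponent m q := by
  ext d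
  rw [coeff_homogeneousComponent, coeff_X_mul', coeff_X_mul', coeff_homogeneousComponent]
  by_cases h : a ∈ d.support
  · have hd : (d - Finsupp.single a 1).degree + 1 = d.degree := by
      conv_rhs => rw [← tsub_add_cancel_of_le (a := Finsupp.single a 1) (b := d)
        (Finsupp.single_le_iff.2 (Nat.one_le_iff_ne_zero.2 (Finsupp.mem_support_iff.1 h)))]
      rw [map_add, Finsupp.degree_single]
    simp only [h, if_true, ← hd, Nat.add_right_cancel_iff]
  · simp [h]

/-- The top component of a product is the product of the top components. -/
theorem homogeneousComponent_mul_of_bounded {p q : MvPolynomial (Fin r) k} {d e : ℕ}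
    (hp : ∀ m, d < m → homogeneousComponent m p = 0)
    (hq : ∀ m, e < m → homogeneousComponent m q = 0) :
    homogeneousComponent (d + e) (p * q)
      = homogeneousComponent d p * homogeneousComponent e q := by
  have coeff_zero : ∀ {p : MvPolynomial (Fin r) k} {d : ℕ},
      (∀ m, d < m → homogeneousComponent m p = 0) → ∀ u, d < u.degree → coeff u p = 0 := by
    intro p d hp u hu
    have := congrArg (coeff u) (hp _ hu)
    rwa [coeff_homogeneousComponent, if_pos rfl, coeff_zero] at this
  ext u
  rw [coeff_homogeneousComponent, coeff_mul, coeff_mul]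
  split_ifs with hu
  · refine Finset.sum_congr rfl fun x hx => ?_
    have hx' : x.1.degree + x.2.degree = d + e := by
      rw [← map_add, Finset.HasAntidiagonal.mem_antidiagonal.1 hx, hu]
    rw [coeff_homogeneousComponent, coeff_homogeneousComponent]
    rcases lt_trichotomy x.1.degree d with h | h | h
    · rw [coeff_zero hq x.2 (by omega), if_neg h.ne, mul_zero, zero_mul]
    · rw [if_pos h, if_pos (by omega)]
    · rw [coeff_zero hp x.1 h, if_neg h.ne', zero_mul, zero_mul]
  · refine (Finset.sum_eq_zero fun x hx => ?_).symm
    have hx' : x.1.degree + x.2.degree = u.degree := by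
      rw [← map_add, Finset.HasAntidiagonal.mem_antidiagonal.1 hx]
    rw [coeff_homogeneousComponent, coeff_homogeneousComponent]
    split_ifs <;> first | omega | simp

/-- The Demazure operator lowers degrees: a bound `e` on the degree of `p` becomes strict. -/
theorem homogeneousComponent_demazure (i : Simple r) {p : MvPolynomial (Fin r) k} {e : ℕ}
    (hp : ∀ m, e < m → homogeneousComponent m p = 0) {m : ℕ} (hm : e ≤ m) :
    homogeneousComponent m (demazure i p) = 0 := by
  apply X_sub_X_mul_cancel i.left_ne_right
  rw [sub_mul, ← homogeneousComponent_X_mul, ← homogeneousComponent_X_mul, ← map_sub, ← sub_mul,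
    X_sub_X_mul_demazure, map_sub, ← rename_homogeneousComponent, hp _ (by omega), map_zero,
    sub_self, mul_zero]

/-- To leading order the deformed action of the symmetric group is the permutation of variables. -/
theorem homogeneousComponent_permOp {g : MvPolynomial (Fin r) k} {e : ℕ} (hg : g.IsHomogeneous e)
    (w : Equiv.Perm (Fin r)) :
    (∀ m, e < m → homogeneousComponent m (permOp w g) = 0) ∧
      homogeneousComponent e (permOp w g) = rename (w⁻¹ : Equiv.Perm (Fin r)) g := by
  have step : ∀ w : Equiv.Perm (Fin r),
      ((∀ m, e < m → homogeneousComponent m (permOp w g) = 0) ∧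
        homogeneousComponent e (permOp w g) = rename (w⁻¹ : Equiv.Perm (Fin r)) g) →
      ∀ i : Simple r, ((∀ m, e < m → homogeneousComponent m (permOp (w * i.perm) g) = 0) ∧
        homogeneousComponent e (permOp (w * i.perm) g)
          = rename ((w * i.perm)⁻¹ : Equiv.Perm (Fin r)) g) := by
    rintro w ⟨h1, h2⟩ i
    rw [permOp_mul, permOp_perm, heckeOp_apply]
    refine ⟨fun m hm => ?_, ?_⟩
    · rw [map_add, homogeneousComponent_demazure i h1 hm.le, ← rename_homogeneousComponent,
        h1 m hm, map_zero, add_zero]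
    · rw [map_add, homogeneousComponent_demazure i h1 le_rfl, ← rename_homogeneousComponent, h2,
        add_zero, rename_rename, ← Equiv.Perm.coe_mul, mul_inv_rev,
        inv_eq_of_mul_eq_one_right i.perm_mul_self]
  have hw : w ∈ Subgroup.closure (Set.range (Simple.perm (r := r))) := by
    rw [closure_range_perm]; exact Subgroup.mem_top w
  induction hw using Subgroup.closure_induction_right with
  | one =>
    rw [permOp_one, inv_one, Equiv.Perm.coe_one, rename_id_apply]
    refine ⟨fun m hm => ?_, ?_⟩
    · rw [homogeneousComponent_of_mem hg, if_neg hm.ne']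
    · rw [homogeneousComponent_of_mem hg, if_pos rfl]
  | mul_right w _ v hv ih =>
    obtain ⟨i, rfl⟩ := hv
    exact step w ih i
  | mul_inv_cancel w _ v hv ih =>
    obtain ⟨i, rfl⟩ := hv
    rw [inv_eq_of_mul_eq_one_right i.perm_mul_self]
    exact step w ih i

/-! ### Independence and separation of points -/

/-- Dedekind's independence of characters over a commutative ring, for characters whose pairwise
differences take values that are not zero divisors. -/
theorem eq_zero_of_sum_mul_monoidHom_eq_zero {ι M R : Type*} [Monoid M] [CommRing R]
    (χ : ι → M →* R) (hχ : ∀ i j, i ≠ j → ∃ m, ∀ a, a * (χ i m - χ j m) = 0 → a = 0)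
    (s : Finset ι) (a : ι → R) (h : ∀ m, ∑ i ∈ s, a i * χ i m = 0) : ∀ i ∈ s, a i = 0 := by
  classical
  induction s using Finset.induction_on generalizing a with
  | empty => simp
  | insert j s hj ih =>
    have hs : ∀ i ∈ s, a i = 0 := by
      intro i hi
      obtain ⟨m₀, hm₀⟩ := hχ i j (fun e => hj (e ▸ hi))
      refine hm₀ _ (ih (fun i => a i * (χ i m₀ - χ j m₀)) (fun m => ?_) i hi)
      have h1 := h (m₀ * m)
      have h2 := h m
      rw [Finset.sum_insert hj] at h1 h2
      have h3 : ∑ i ∈ s, a i * (χ i m₀ - χ j m₀) * χ i m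
          = ∑ i ∈ s, a i * χ i (m₀ * m) - χ j m₀ * ∑ i ∈ s, a i * χ i m := by
        rw [Finset.mul_sum, ← Finset.sum_sub_distrib]
        refine Finset.sum_congr rfl fun i _ => ?_
        rw [map_mul]
        ring
      rw [h3]
      rw [map_mul] at h1
      linear_combination h1 - χ j m₀ * h2
    intro i hi
    rcases Finset.mem_insert.1 hi with rfl | hi
    · have := h 1
      rwa [Finset.sum_insert hj, Finset.sum_eq_zero (fun i hi => by rw [hs i hi, zero_mul]),
        add_zero, map_one, mul_one] at this
    · exact hs i hi

/-- The homogeneous polynomials that are symmetric in the variables of each block. -/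
def blockMonoid (k : Type*) [CommRing k] (c : Comp n r) :
    Submonoid (MvPolynomial (Fin r) k) where
  carrier := {g | (∃ e, g.IsHomogeneous e) ∧ ∀ w ∈ parabolic c, rename w g = g}
  one_mem' := ⟨⟨0, isHomogeneous_one _ _⟩, fun _ _ => map_one _⟩
  mul_mem' := by
    rintro f g ⟨⟨d, hd⟩, hf⟩ ⟨⟨e, he⟩, hg⟩
    exact ⟨⟨d + e, hd.mul he⟩, fun w hw => by rw [map_mul, hf w hw, hg w hw]⟩

open Classical in
/-- The sum of the variables in a block. -/
def blockSum (k : Type*) [CommRing k] (c : Comp n r) (b : Fin n) : MvPolynomial (Fin r) k :=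
  ∑ j with InBlock c b j, X j

open Classical in
theorem rename_blockSum (b : Fin n) (w : Equiv.Perm (Fin r)) :
    rename (w⁻¹ : Equiv.Perm (Fin r)) (blockSum k c b) = ∑ j with InBlock c b (w j), X j := by
  rw [blockSum, map_sum, Finset.sum_filter, Finset.sum_filter, ← Equiv.sum_comp w]
  refine Finset.sum_congr rfl fun j _ => ?_
  rw [rename_X, show w⁻¹ (w j) = j from w.symm_apply_apply j]

theorem blockSum_mem (b : Fin n) : blockSum k c b ∈ blockMonoid k c := by
  classical
  refine ⟨⟨1, IsHomogeneous.sum _ _ _ fun j _ => isHomogeneous_X _ _⟩, fun w hw => ?_⟩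
  have := rename_blockSum (k := k) (c := c) b w⁻¹
  rw [inv_inv] at this
  rw [this, blockSum]
  refine Finset.sum_congr (Finset.filter_congr fun j _ => ?_) fun _ _ => rfl
  exact inv_mem hw b j

theorem degreeOf_sum_X_eq_zero {a : Fin r} (s : Finset (Fin r)) (h : a ∉ s) :
    degreeOf a (∑ j ∈ s, X j : MvPolynomial (Fin r) k) = 0 := by
  classical
  refine Nat.le_zero.1 (degreeOf_le_iff.2 fun d hd => Nat.le_zero.2 ?_)
  by_contra hda
  rw [mem_support_iff, coeff_sum] at hd
  refine hd (Finset.sum_eq_zero fun j hj => ?_)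
  rw [coeff_X]
  refine if_neg fun e => hda ?_
  rw [← e, Finsupp.single_eq_of_ne (fun e' => h (by rwa [e']))]

/-- A difference of sums of variables over two sets is not a zero divisor if the sets differ. -/
theorem eq_zero_of_mul_sub_eq_zero {s t : Finset (Fin r)} (hst : s ≠ t)
    {g : MvPolynomial (Fin r) k} (h : g * (∑ j ∈ s, X j - ∑ j ∈ t, X j) = 0) : g = 0 := by
  classical
  have key : ∀ s t : Finset (Fin r), ∀ a ∈ s, a ∉ t →
      g * (∑ j ∈ s, X j - ∑ j ∈ t, X j) = 0 → g = 0 := by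
    intro s t a hs ht h
    refine eq_zero_of_X_mul_eq_mul (j := a) (q := ∑ j ∈ t, X j - ∑ j ∈ s.erase a, X j) ?_ ?_
    · refine Nat.le_zero.1 ((degreeOf_sub_le _ _ _).trans ?_)
      rw [degreeOf_sum_X_eq_zero _ ht, degreeOf_sum_X_eq_zero _ (Finset.notMem_erase a s),
        max_self]
    · rw [← Finset.add_sum_erase s _ hs] at h
      linear_combination h
  by_cases hs : s ⊆ t
  · obtain ⟨a, ha, ha'⟩ := Finset.exists_of_ssubset (hs.ssubset_of_ne hst)
    exact key t s a ha ha' (by linear_combination -h)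
  · obtain ⟨a, ha, ha'⟩ := Finset.not_subset.1 hs
    exact key s t a ha ha' h

/-- Restricting the renaming of variables by the inverses of permutations in different cosets to
block-symmetric polynomials gives different characters. -/
theorem exists_rename_sub_rename_regular {v w : Equiv.Perm (Fin r)}
    (h : Coset.mk c v ≠ Coset.mk c w) :
    ∃ m ∈ blockMonoid k c, ∀ a, a * (rename (v⁻¹ : Equiv.Perm (Fin r)) m
      - rename (w⁻¹ : Equiv.Perm (Fin r)) m) = 0 → a = 0 := by
  classical
  have h1 : ¬ ∀ b j, InBlock c b ((w * v⁻¹) j) ↔ InBlock c b j := fun h' =>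
    h (Coset.mk_eq_mk.2 h')
  push Not at h1
  obtain ⟨b, j, hbj⟩ := h1
  refine ⟨blockSum k c b, blockSum_mem b, fun a ha => ?_⟩
  rw [rename_blockSum, rename_blockSum] at ha
  refine eq_zero_of_mul_sub_eq_zero (fun e => ?_) ha
  have h2 := Finset.ext_iff.1 e (v⁻¹ j)
  simp only [Finset.mem_filter, Finset.mem_univ, true_and, 
    show v (v⁻¹ j) = j from v.apply_symm_apply j] at h2
  rw [Equiv.Perm.mul_apply] at hbj
  tauto

/-- Homomorphisms to the polynomial module separate the points of `M(c) ⊗_{k S_r} AH_r`. -/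
theorem IndMod.eq_zero_of_forall_apply_eq_zero {v : IndMod k c}
    (hv : ∀ φ : IndMod k c →ₗ[(AH k r)ᵐᵒᵖ] MvPolynomial (Fin r) k, φ v = 0) : v = 0 := by
  classical
  have := Fintype.ofFinite (Coset c)
  obtain ⟨p, rfl⟩ := IndMod.exists_eq_sum v
  choose w hw using Coset.exists_mk (c := c)
  have hsum : ∀ g (hg : ∀ w ∈ parabolic c, rename w g = g), ∑ y, p y * permOp (w y) g = 0 := by
    intro g hg
    rw [← hv (blockMap c g hg), map_sum]
    refine Finset.sum_congr rfl fun y _ => ?_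
    rw [← blockMap_tmul hg, hw]
  -- Descending induction on a strict bound for the degrees of the coefficients.
  have key : ∀ d, (∀ y m, d ≤ m → homogeneousComponent m (p y) = 0) → ∀ y, p y = 0 := by
    intro d
    induction d with
    | zero =>
      intro h y
      ext u
      have := congrArg (coeff u) (h y u.degree (Nat.zero_le _))
      rwa [coeff_homogeneousComponent, if_pos rfl] at this
    | succ d ih =>
      intro h
      refine ih fun y m hm => ?_
      rcases hm.eq_or_lt with rfl | hm
      · refine eq_zero_of_sum_mul_monoidHom_eq_zero
          (fun y => ((rename ((w y)⁻¹ : Equiv.Perm (Fin r)) :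
              MvPolynomial (Fin r) k →ₐ[k] _) : MvPolynomial (Fin r) k →* _).comp
            (blockMonoid k c).subtype) ?_ Finset.univ
          (fun y => homogeneousComponent d (p y)) ?_ y (Finset.mem_univ y)
        · intro y z hyz
          obtain ⟨m, hm, hreg⟩ := exists_rename_sub_rename_regular (k := k) (c := c)
            (v := w y) (w := w z) (by rwa [hw, hw])
          exact ⟨⟨m, hm⟩, hreg⟩
        · rintro ⟨g, ⟨e, he⟩, hg⟩
          have := congrArg (homogeneousComponent (d + e)) (hsum g hg)
          rw [map_sum, map_zero] at this
          rw [← this]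
          refine Finset.sum_congr rfl fun y _ => ?_
          obtain ⟨h1, h2⟩ := homogeneousComponent_permOp he (w y)
          rw [homogeneousComponent_mul_of_bounded (fun m hm => h y m hm) h1, h2]
          rfl
      · exact h y m hm
  have hp := key (Finset.univ.sup (fun y => (p y).totalDegree) + 1) fun y m hm =>
    homogeneousComponent_eq_zero _ _
      ((Nat.lt_succ_of_le (Finset.le_sup (f := fun y => (p y).totalDegree)
        (Finset.mem_univ y))).trans_le hm)
  refine Finset.sum_eq_zero fun y _ => ?_
  rw [hp, map_zero, IndMod.tmul, Finsupp.single_zero]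
  rfl

end Separation

/-! ### The polynomial module as a direct summand of the tensor module -/

section Retract

variable {k : Type*} [CommRing k] {n r : ℕ} {c : Comp n r}

/-- The composition `(r, 0, …, 0)`. -/
def oneBlock (n r : ℕ) (hn : 1 ≤ n) : Comp n r := ⟨Pi.single ⟨0, hn⟩ r, by simp⟩

theorem parabolic_oneBlock (hn : 1 ≤ n) : parabolic (oneBlock n r hn) = ⊤ := by
  have key : ∀ (b : Fin n) (j : Fin r), InBlock (oneBlock n r hn) b j ↔ b = ⟨0, hn⟩ := by
    intro b j
    have hj := j.2
    constructor
    · intro h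
      by_contra hb
      have hb' : (⟨0, hn⟩ : Fin n) < b :=
        Fin.lt_def.2 (Nat.pos_of_ne_zero fun e => hb (Fin.ext e))
      have h1 : r ≤ ∑ a ∈ Finset.Iio b, (oneBlock n r hn).1 a := by
        refine le_trans ?_ (Finset.single_le_sum (fun _ _ => Nat.zero_le _)
          (Finset.mem_Iio.2 hb'))
        simp [oneBlock]
      have h2 := h.1
      omega
    · rintro rfl
      constructor
      · rw [Finset.sum_eq_zero]
        · exact Nat.zero_le _
        · intro a ha
          rw [Finset.mem_Iio, Fin.lt_def] at ha
          exact absurd ha (Nat.not_lt_zero _)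
      · refine hj.trans_le (le_trans ?_ (Finset.single_le_sum (fun _ _ => Nat.zero_le _)
          (Finset.mem_Iic.2 le_rfl)))
        simp [oneBlock]
  rw [eq_top_iff]
  intro w _ b j
  rw [key, key]

theorem Coset.eq_mk_one (hc : parabolic c = ⊤) (y : Coset c) : y = Coset.mk c 1 := by
  obtain ⟨w, rfl⟩ := y.exists_mk
  rw [Coset.mk_eq_mk, hc]
  exact Subgroup.mem_top _

/-- If `c` has only one nonzero part, `g ↦ m_c ⊗ g` is a homomorphism from the polynomial
module. -/
def polyToInd (hc : parabolic c = ⊤) : MvPolynomial (Fin r) k →ₗ[(AH k r)ᵐᵒᵖ] IndMod k c where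
  toFun g := IndMod.tmul k (Coset.mk c 1) (AH.ofPoly k r g)
  map_add' f g := by rw [map_add, IndMod.tmul_add]
  map_smul' a := by
    obtain ⟨a, rfl⟩ := MulOpposite.op_surjective a
    simp only [RingHom.id_apply]
    induction a using AH.induction with
    | hC a =>
      intro g
      rw [IndMod.op_smul_tmul, ← ofPoly_C, op_ofPoly_smul, mul_comm, map_mul]
    | hx i =>
      intro g
      rw [IndMod.op_smul_tmul, op_x_smul, mul_comm, map_mul, AH.ofPoly_X]
    | hs i =>
      intro g
      rw [IndMod.op_smul_tmul, ofPoly_mul_s, IndMod.tmul_add, ← IndMod.tmul_act,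
        Coset.eq_mk_one hc (Coset.act _ _), ← IndMod.tmul_add, ← map_add, op_s_smul,
        heckeOp_apply]
    | hadd a b ha hb =>
      intro g
      rw [MulOpposite.op_add, add_smul, add_smul, map_add, IndMod.tmul_add, ha, hb]
    | hmul a b ha hb =>
      intro g
      rw [MulOpposite.op_mul, mul_smul, mul_smul, hb, ha]

variable (k) in
/-- The embedding of the polynomial module as the summand of the tensor module indexed by the
composition `(r, 0, …, 0)`. -/
def polyIncl (r : ℕ) (hn : 1 ≤ n) :
    MvPolynomial (Fin r) k →ₗ[(AH k r)ᵐᵒᵖ] TensorMod k n r :=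
  DirectSum.lof (AH k r)ᵐᵒᵖ (Comp n r) (fun c => IndMod k c) (oneBlock n r hn) ∘ₗ
    polyToInd (parabolic_oneBlock hn)

theorem exists_comp_polyIncl_eq_id (hn : 1 ≤ n) :
    ∃ π : TensorMod k n r →ₗ[(AH k r)ᵐᵒᵖ] MvPolynomial (Fin r) k,
      ∀ g, π (polyIncl k r hn g) = g := by
  refine ⟨blockMap (oneBlock n r hn) 1 (fun _ _ => map_one _) ∘ₗ
    DirectSum.component (AH k r)ᵐᵒᵖ (Comp n r) (fun c => IndMod k c) (oneBlock n r hn),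
    fun g => ?_⟩
  rw [polyIncl, LinearMap.comp_apply, LinearMap.comp_apply, DirectSum.component.lof_self]
  refine (blockMap_tmul _ _ _).trans ?_
  rw [permOp_one, mul_one]

theorem TensorMod.eq_zero_of_forall_apply_eq_zero {v : TensorMod k n r}
    (hv : ∀ φ : TensorMod k n r →ₗ[(AH k r)ᵐᵒᵖ] MvPolynomial (Fin r) k, φ v = 0) : v = 0 := by
  refine DFinsupp.ext fun c => IndMod.eq_zero_of_forall_apply_eq_zero fun φ => ?_
  exact hv (φ ∘ₗ DirectSum.component (AH k r)ᵐᵒᵖ (Comp n r) (fun c => IndMod k c) c)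

end Retract

/-! ### The center of the degenerate affine Schur algebra -/

section Center

variable {k : Type*} [CommRing k] {n r : ℕ}

theorem symEnd_apply (c : Comp n r) (f : symmetricSubalgebra (Fin r) k) (v : IndMod k c) :
    symEnd k c f v = MulOpposite.op (AH.ofPoly k r f.1) • v := by
  induction v using IndMod.induction with
  | h0 => rw [map_zero, smul_zero]
  | hadd u v hu hv => rw [map_add, smul_add, hu, hv]
  | htmul y a =>
    rw [IndMod.op_smul_tmul, ← ofPoly_mul_comm f.2]
    refine (Submodule.mapQ_apply _ _ _ _).trans ?_
    simp [IndMod.tmul, mulLeftEnd]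

/-- `f 1_{n,r}` is right multiplication by the central element `f` of `AH_r`. -/
theorem polyOne_apply (f : symmetricSubalgebra (Fin r) k) (v : TensorMod k n r) :
    polyOne k n f v = MulOpposite.op (AH.ofPoly k r f.1) • v := by
  refine DFinsupp.ext fun c => ?_
  have : polyOne k n f v = ∑ c, polyIdem k c f v := LinearMap.sum_apply _ _ _
  rw [this]
  have h : ∀ d : Comp n r, DirectSum.component (AH k r)ᵐᵒᵖ (Comp n r) (fun c => IndMod k c) c
      (polyIdem k d f v) = if d = c then MulOpposite.op (AH.ofPoly k r f.1) • v c else 0 := by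
    intro d
    split_ifs with hd
    · subst hd
      refine (DirectSum.component.lof_self _ _ _).trans ?_
      rw [LinearMap.comp_apply, symEnd_apply]
      rfl
    · exact (DirectSum.component.of _ _ _ _).trans (dif_neg hd)
  change DirectSum.component (AH k r)ᵐᵒᵖ (Comp n r) (fun c => IndMod k c) c _ = _
  rw [map_sum, Finset.sum_congr rfl fun d _ => h d, Finset.sum_ite_eq', if_pos (Finset.mem_univ _)]
  rfl

variable (k n r) in
/-- The map `f ↦ f 1_{n,r}` as a homomorphism of algebras. -/
def polyOneHom : symmetricSubalgebra (Fin r) k →ₐ[k] AS k n r where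
  toFun := polyOne k n
  map_one' := LinearMap.ext fun v => by
    rw [polyOne_apply, OneMemClass.coe_one, map_one, MulOpposite.op_one, one_smul]; rfl
  map_mul' f g := LinearMap.ext fun v => by
    rw [Module.End.mul_apply, polyOne_apply, polyOne_apply, polyOne_apply, ← mul_smul,
      ← MulOpposite.op_mul, mul_comm, MulMemClass.coe_mul, map_mul]
  map_zero' := LinearMap.ext fun v => by
    rw [polyOne_apply, ZeroMemClass.coe_zero, map_zero, MulOpposite.op_zero, zero_smul]; rfl
  map_add' f g := LinearMap.ext fun v => by
    rw [LinearMap.add_apply, polyOne_apply, polyOne_apply, polyOne_apply, ← add_smul,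
      ← MulOpposite.op_add, ← map_add]; rfl
  commutes' a := LinearMap.ext fun v => by
    rw [polyOne_apply, Module.algebraMap_end_apply,
      show AH.ofPoly k r (algebraMap k (symmetricSubalgebra (Fin r) k) a).1
        = algebraMap k (AH k r) a from ofPoly_C a]
    exact algebraMap_smul (AH k r)ᵐᵒᵖ a v

theorem polyOne_mem_center (f : symmetricSubalgebra (Fin r) k) :
    polyOne k n f ∈ Subalgebra.center k (AS k n r) := by
  rw [Subalgebra.mem_center_iff]
  refine fun z => LinearMap.ext fun v => ?_
  rw [Module.End.mul_apply, Module.End.mul_apply, polyOne_apply, polyOne_apply, map_smul]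

theorem polyOne_injective (hn : 1 ≤ n) :
    Function.Injective (polyOne k n : symmetricSubalgebra (Fin r) k → AS k n r) := by
  intro f g hfg
  obtain ⟨π, hπ⟩ := exists_comp_polyIncl_eq_id (k := k) (r := r) hn
  have := congrArg π (LinearMap.congr_fun hfg (polyIncl k r hn 1))
  rw [polyOne_apply, polyOne_apply, map_smul, map_smul, hπ, op_ofPoly_smul, op_ofPoly_smul,
    mul_one, mul_one] at this
  exact Subtype.ext this

theorem isSymmetric_of_heckeOp {f : MvPolynomial (Fin r) k} (h : ∀ i, heckeOp i f = f) :
    f.IsSymmetric := by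
  intro w
  have hw : w ∈ Subgroup.closure (Set.range (Simple.perm (r := r))) := by
    rw [closure_range_perm]; exact Subgroup.mem_top w
  induction hw using Subgroup.closure_induction with
  | mem v hv =>
    obtain ⟨i, rfl⟩ := hv
    exact rename_eq_self_of_heckeOp_eq_self (h i)
  | one => rw [Equiv.Perm.coe_one, rename_id_apply]
  | mul v w _ _ hv hw => rw [Equiv.Perm.coe_mul, ← rename_rename, hw, hv]
  | inv v _ hv =>
    conv_lhs => rw [← hv]
    rw [rename_rename, ← Equiv.Perm.coe_mul, inv_mul_cancel, Equiv.Perm.coe_one, rename_id_apply]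

/-- The endomorphisms of the polynomial module are the multiplications by symmetric polynomials,
because the module is generated by `1`, which is fixed by the `s_i`. -/
theorem exists_eq_mul_of_endomorphism
    (φ : MvPolynomial (Fin r) k →ₗ[(AH k r)ᵐᵒᵖ] MvPolynomial (Fin r) k) :
    ∃ f : symmetricSubalgebra (Fin r) k, ∀ g, φ g = MulOpposite.op (AH.ofPoly k r f.1) • g := by
  refine ⟨⟨φ 1, isSymmetric_of_heckeOp fun i => ?_⟩, fun g => ?_⟩
  · rw [← op_s_smul, ← map_smul, op_s_smul, heckeOp_eq_self (map_one _)]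
  · have : g = MulOpposite.op (AH.ofPoly k r g) • (1 : MvPolynomial (Fin r) k) := by
      rw [op_ofPoly_smul, mul_one]
    conv_lhs => rw [this, map_smul, op_ofPoly_smul]
    rw [op_ofPoly_smul, mul_comm]

/-- A central endomorphism `z` restricts to multiplication by a symmetric polynomial `f` on the
summand `P_r`; since homomorphisms to `P_r` are intertwined by `z` and this restriction, and
separate points, `z` is multiplication by `f` everywhere. -/
theorem exists_polyOne_eq_of_mem_center (hn : 1 ≤ n) {z : AS k n r}
    (hz : z ∈ Subalgebra.center k (AS k n r)) :
    ∃ f : symmetricSubalgebra (Fin r) k, polyOne k n f = z := by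
  obtain ⟨π, hπ⟩ := exists_comp_polyIncl_eq_id (k := k) (r := r) hn
  obtain ⟨f, hf⟩ := exists_eq_mul_of_endomorphism (π ∘ₗ z ∘ₗ polyIncl k r hn)
  refine ⟨f, LinearMap.ext fun v => ?_⟩
  rw [← sub_eq_zero]
  refine TensorMod.eq_zero_of_forall_apply_eq_zero fun φ => ?_
  have h1 := LinearMap.congr_fun (Subalgebra.mem_center_iff.1 hz (polyIncl k r hn ∘ₗ φ)) v
  have h2 : φ (z v) = π (z (polyIncl k r hn (φ v))) := by
    rw [← hπ (φ (z v))]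
    exact congrArg π h1
  rw [map_sub, polyOne_apply, map_smul, h2, sub_eq_zero]
  exact (hf (φ v)).symm

end Center

end DegAffSchur

end

theorem theorem6p5 (k : Type*) [CommRing k] (n r : ℕ) (hn : 1 ≤ n) :
    ∃ e : MvPolynomial.symmetricSubalgebra (Fin r) k ≃ₐ[k]
        Subalgebra.center k (DegAffSchur.AS k n r),
      ∀ f, (e f : DegAffSchur.AS k n r) = DegAffSchur.polyOne k n f := by
  refine ⟨AlgEquiv.ofBijective
    ((DegAffSchur.polyOneHom k n r).codRestrict _ DegAffSchur.polyOne_mem_center) ⟨?_, ?_⟩,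
    fun f => rfl⟩
  · intro f g hfg
    exact DegAffSchur.polyOne_injective hn (congrArg Subtype.val hfg)
  · rintro ⟨z, hz⟩
    obtain ⟨f, hf⟩ := DegAffSchur.exists_polyOne_eq_of_mem_center hn hz
    exact ⟨f, Subtype.ext hf⟩
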